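/- For $\beta>1$ let $\iota(\beta)=\beta/(1-\beta e^{-(\beta-1)})$, and let $\kappa^*=\min_{\beta>1}\iota(\beta)\approx 4.911$. Definitions. A $k$-CNF formula $\Phi$ over $x_1,\dots,x_n$ with $m$ clauses is an ordered $m$-tuple of ordered $k$-tuples of the $2n$ literals $x_i,\bar x_i$ (repetitions allowed); $\Phi_k(n,m)$ is the uniform distribution on these formulas. A formula is identified with its one-hot encoding in $\{0,1\}^N$, $N=m\cdot k\cdot 2n$, which records for each clause $i$, position $j$ and literal $s$ whether the $j$th literal of clause $i$ is $s$. A random degree-$D$ polynomial is a function $f:\mathbb R^N\times\Omega\to\mathbb R^n$, for a probability space $(\Omega,\mathbb P_\omega)$, such that for each $\omega$ every coordinate of $f(\cdot,\omega)$ is a real polynomial of degree at most $D$, with coefficients that are random variables on $\Omega$; $\omega$ is independent of $\Phi$. Let $\mathrm{round}(x)=\mathtt T$ if $x\ge 1$, $\mathtt F$ if $x\le -1$, and $\mathtt{err}$ otherwise, applied coordinatewise. A word $x\in\{\mathtt T,\mathtt F,\mathtt{err}\}^n$ $(\eta,\nu)$-satisfies $\Phi$ if some $y\in\{\mathtt T,\mathtt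 F\}^n$ satisfies at least $(1-\nu)m$ clauses of $\Phi$ and differs from $x$ in at most $\eta n$ coordinates. For $\delta,\eta,\nu\in[0,1]$ and $\gamma\ge 1$, $f$ $(\delta,\gamma,\eta,\nu)$-solves $\Phi_k(n,m)$ if, for independent $\Phi\sim\Phi_k(n,m)$ and $\omega\sim\mathbb P_\omega$, $$\mathbb P_{\Phi,\omega}\big[\mathrm{round}(f(\Phi,\omega))\ (\eta,\nu)\text{-satisfies }\Phi\big]\ge 1-\delta\quad\text{and}\quad \mathbb E_{\Phi,\omega}\|f(\Phi,\omega)\|_2^2\le\gamma n.$$ Theorem (hardness for low degree polynomials). Fix $\kappa>\kappa^*$, and let $\alpha=\kappa 2^k\log k/k$ and $m=\lfloor\alpha n\rfloor$. There are $c>0$ and $k^*\ge 1$, depending only on $\kappa$, such that for every $k\ge k^*$ there are $n^*\ge 1$, $\eta\in[c/k,1]$ and $C_1,C_2>0$, depending only on $\kappa$ and $k$, with the following property. Let $\nu=\frac1{k^2 2^k}$. If $n\ge n^*$, $\gamma\ge 1$ is real, $D$ is an integer with $1\le D\le \frac{C_1 n}{\gamma\log n}$, and $0\le\delta\le\exp(-C_2\gamma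 D\log n)$, then there is no random degree-$D$ polynomial that $(\delta,\gamma,\eta,\nu)$-solves $\Phi_k(n,m)$. -/

import Mathlib

open MeasureTheory

namespace RandomKSAT

noncomputable section

/-! ### The constant `κ*` -/

/-- `ι(β) = β / (1 - β e^{-(β-1)})`, considered on `(1, ∞)`, where its denominator is positive. -/
def iota (β : ℝ) : ℝ := β / (1 - β * Real.exp (-(β - 1)))

/-- `κ* = min_{β > 1} ι(β)`. The minimum is attained, see `kappaStar_isLeast`. -/
def kappaStar : ℝ := sInf (iota '' Set.Ioi 1)

theorem iota_denom_pos {β : ℝ} (hβ : 1 < β) : 0 < 1 - β * Real.exp (-(β - 1)) := by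
  have h1 : β < Real.exp (β - 1) := by
    have := Real.add_one_lt_exp (x := β - 1) (by linarith)
    linarith
  have h2 : β * Real.exp (-(β - 1)) < Real.exp (β - 1) * Real.exp (-(β - 1)) :=
    mul_lt_mul_of_pos_right h1 (Real.exp_pos _)
  rw [← Real.exp_add] at h2
  simp only [add_neg_cancel, Real.exp_zero] at h2
  linarith

theorem kappaStar_isLeast : IsLeast (iota '' Set.Ioi 1) kappaStar := by
  have hcont : ContinuousOn iota (Set.Icc (4 / 3) 8) := by
    unfold iota
    refine ContinuousOn.div (by fun_prop) (by fun_prop) ?_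
    intro x hx
    exact (iota_denom_pos (by linarith [hx.1])).ne'
  obtain ⟨b, hb, hmin⟩ := isCompact_Icc.exists_isMinOn ⟨2, by norm_num, by norm_num⟩ hcont
  have h2 : iota 2 ≤ 8 := by
    have he := Real.exp_one_gt_d9
    have h3 : Real.exp (-((2 : ℝ) - 1)) ≤ 3 / 8 := by
      have : -(2 - 1 : ℝ) = -1 := by norm_num
      rw [this, Real.exp_neg, inv_le_comm₀ (Real.exp_pos _) (by norm_num)]
      linarith
    unfold iota
    generalize Real.exp (-((2 : ℝ) - 1)) = e at h3
    rw [div_le_iff₀ (by linarith)]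
    linarith
  have hb2 : iota b ≤ 8 := (hmin (show (2 : ℝ) ∈ Set.Icc (4 / 3) 8 by norm_num)).trans h2
  have hleast : IsLeast (iota '' Set.Ioi 1) (iota b) := by
    refine ⟨⟨b, by have := hb.1; simp only [Set.mem_Ioi]; linarith, rfl⟩, ?_⟩
    rintro _ ⟨x, hx, rfl⟩
    have hx1 : (1 : ℝ) < x := hx
    have hd := iota_denom_pos hx1
    by_cases hlo : x < 4 / 3
    · refine hb2.trans ?_
      unfold iota
      rw [le_div_iff₀ hd]
      have := Real.add_one_le_exp (-(x - 1))
      nlinarith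
    · by_cases hhi : 8 < x
      · refine hb2.trans ?_
        unfold iota
        rw [le_div_iff₀ hd]
        have := mul_pos (by linarith : (0 : ℝ) < x) (Real.exp_pos (-(x - 1)))
        linarith
      · exact hmin ⟨by linarith, by linarith⟩
  have : kappaStar = iota b := hleast.csInf_eq
  rw [this]
  exact hleast

/-! ### Random `k`-SAT -/

/-- A literal over the variables `x_0, …, x_{n-1}`: `(i, true)` is `x_i` and `(i, false)` is the
negation of `x_i`. -/
abbrev Literal (n : ℕ) : Type := Fin n × Bool

/-- A `k`-CNF formula with `m` clauses over `n` variables: an ordered `m`-tuple of ordered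
`k`-tuples of literals, repetitions allowed. -/
abbrev Formula (k n m : ℕ) : Type := Fin m → Fin k → Literal n

/-- The law of random `k`-SAT: the uniform distribution on all formulas. -/
def randomKSAT (k n m : ℕ) : Measure (Formula k n m) := ProbabilityTheory.uniformOn Set.univ

/-- The assignment `y` satisfies the clause `C`: some literal of `C` is true under `y`. -/
def SatisfiesClause {k n : ℕ} (y : Fin n → Bool) (C : Fin k → Literal n) : Prop :=
  ∃ j, y (C j).1 = (C j).2

/-- `y` `ν`-satisfies `Φ`: at least `(1 - ν) m` of the clauses are satisfied. -/
def NuSatisfies {k n m : ℕ} (ν : ℝ) (y : Fin n → Bool) (Φ : Formula k n m) : Prop :=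
  (1 - ν) * m ≤ ({i : Fin m | SatisfiesClause y (Φ i)}.ncard : ℝ)

/-- Normalized Hamming distance between words with values in `{T, F, err}`; `none` is `err`. -/
def normHamming {n : ℕ} (x y : Fin n → Option Bool) : ℝ := (hammingDist x y : ℝ) / n

/-- `x ∈ {T, F, err}^n` `(η, ν)`-satisfies `Φ`: it is within normalized Hamming distance `η` of
some `ν`-satisfying `y ∈ {T, F}^n`. -/
def EtaNuSatisfies {k n m : ℕ} (η ν : ℝ) (x : Fin n → Option Bool) (Φ : Formula k n m) : Prop :=
  ∃ y : Fin n → Bool, normHamming x (fun i => some (y i)) ≤ η ∧ NuSatisfies ν y Φ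

/-! ### Low degree polynomials -/

/-- Rounding a real output: true if `≥ 1`, false if `≤ -1`, and `err` (`none`) otherwise. -/
def roundOutput (x : ℝ) : Option Bool :=
  if 1 ≤ x then some true else if x ≤ -1 then some false else none

/-- The `N = m · k · 2n` input coordinates: (clause, position in the clause, literal). -/
abbrev InputIndex (k n m : ℕ) : Type := Fin m × Fin k × Literal n

/-- One-hot encoding of a formula as a vector in `{0,1}^N`. -/
def encode {k n m : ℕ} (Φ : Formula k n m) : InputIndex k n m → ℝ :=
  fun p => if Φ p.1 p.2.1 = p.2.2 then 1 else 0

/-- A degree-`D` polynomial `ℝ^σ → ℝ^n`: every coordinate is a real polynomial of total degree at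
most `D`. -/
def IsDegreePoly {σ : Type*} {n : ℕ} (D : ℕ) (f : (σ → ℝ) → EuclideanSpace ℝ (Fin n)) : Prop :=
  ∃ p : Fin n → MvPolynomial σ ℝ, (∀ i, (p i).totalDegree ≤ D) ∧
    ∀ x i, f x i = MvPolynomial.eval x (p i)

/-- A random degree-`D` polynomial `ℝ^σ × Ω → ℝ^n`: a degree-`D` polynomial for each `ω`, whose
values are random variables (for a bounded degree and finite `σ`, this is the same as asking that
the coefficients be random variables). -/
structure IsRandomDegreePoly {σ Ω : Type*} [MeasurableSpace Ω] {n : ℕ} (D : ℕ)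
    (f : (σ → ℝ) → Ω → EuclideanSpace ℝ (Fin n)) : Prop where
  poly : ∀ ω, IsDegreePoly D (fun x => f x ω)
  measurable : ∀ x, Measurable (f x)

/-- `f` `(δ, γ, η, ν)`-solves random `k`-SAT. The formula `Φ` and the internal randomness
`ω ~ P` are independent. -/
structure Solves {k n m : ℕ} {Ω : Type*} [MeasurableSpace Ω] (P : Measure Ω)
    (f : (InputIndex k n m → ℝ) → Ω → EuclideanSpace ℝ (Fin n)) (δ γ η ν : ℝ) : Prop where
  success : 1 - δ ≤ ((randomKSAT k n m).prod P).real
    {q | EtaNuSatisfies η ν (fun i => roundOutput (f (encode q.1) q.2 i)) q.1}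
  integrable : Integrable (fun q : Formula k n m × Ω => ‖f (encode q.1) q.2‖ ^ 2)
    ((randomKSAT k n m).prod P)
  normalization : ∫ q : Formula k n m × Ω, ‖f (encode q.1) q.2‖ ^ 2 ∂((randomKSAT k n m).prod P)
    ≤ γ * n

/-- The number of clauses `m = ⌊α n⌋` at clause density `α = κ 2^k log k / k`. -/
def numClauses (κ : ℝ) (k n : ℕ) : ℕ := ⌊κ * 2 ^ k * Real.log k / k * n⌋₊

end

end RandomKSAT

/-!
# Low degree hardness of random `k`-SAT

Suppose a degree-`D` polynomial solves random `k`-SAT with very high probability. Run it along a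
path of formulas in which one clause at a time is replaced by a fresh one, cyclically, `k` times
around. The argument compares the probabilities of the following events.

* *Stability* (`prob_stable_ge`). The total influence of a degree-`D` function is at most `D` times
  its second moment (`total_influence_le`), so in expectation the output makes only `O(γ D)` jumps
  of squared norm of order `n / k` along the path. By Jensen's inequality, applied to the
  reversible chain that refuses to jump (`expect_log_step`, `prob_path_ge`), the probability of no
  jump at all is at least `exp (-O(γ D log n))`.
* *Overlap gap* (`prob_exists_chain_le`). Consider `k + 1` words, each nearly satisfying some formula
  of the path, such that the conditional entropy of each word given the earlier ones is close to
  `β log k / k`. There are about `exp (n (log 2 + β log k))` such sequences (`card_condEnt_le`). A new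
  word `y` violates a given random clause with probability `2 ^ (-k)`, and the conditional
  probability that an earlier word violates it too is at most `β e^{-(β-1)} + o(1)`: this is
  Chernoff's bound for the total information of `y` along the `k` variables of the clause
  (`prob_exists_agree_le`, `tendsto_coViolBound`). Hence the first moment is exponentially small as
  soon as `κ (1 - β e^{-(β-1)}) > β`, which is `κ > ι(β)`.
* *Freshness* (`prob_fresh_le`). After `m` steps the formula is independent of the past, and a word of
  conditional entropy at most `β log k / k` given words that depend on the past is unlikely to
  nearly satisfy it.

On a stable path along which the polynomial always succeeds, the conditional entropy of the output
given the earlier words of a chain starts from `0`, moves in small steps by Gibbs' inequality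
(`condEnt_le_add`), and is large after `m` steps by freshness; so the chain can be prolonged `k`
times, against the overlap gap (`exists_chain`). Stability would therefore be less likely than the
sum of the failure probabilities (`exp_neg_stability_le`), which contradicts the choice of the
constants (`no_balance`).

All probabilities over formulas are finite averages, written with `Finset.expect`.
-/

namespace RandomKSAT

noncomputable section

open Finset BigOperators Function

set_option linter.unusedSectionVars false

/-! ### Finite averages -/

/-- Resampling one coordinate preserves the uniform distribution. -/
lemma expect_update {ι A : Type*} [Fintype ι] [DecidableEq ι] [Fintype A] [Nonempty A] (i : ι)
    (F : (ι → A) → ℝ) : 𝔼 x : ι → A, 𝔼 a : A, F (update x i a) = 𝔼 x, F x := by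
  have h1 : 𝔼 x : ι → A, 𝔼 a : A, F (update x i a)
      = 𝔼 q : (ι → A) × A, F (update q.1 i q.2) := by
    rw [← univ_product_univ, expect_product]
  have h2 : 𝔼 q : (ι → A) × A, F (update q.1 i q.2) = 𝔼 q : (ι → A) × A, F q.1 := by
    refine Fintype.expect_equiv (Involutive.toPerm
      (fun q : (ι → A) × A => (update q.1 i q.2, q.1 i)) ?_) _ _ ?_
    · rintro ⟨x, a⟩
      simp
    · rintro ⟨x, a⟩
      rfl
  have h3 : 𝔼 q : (ι → A) × A, F q.1 = 𝔼 x, F x := by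
    rw [← univ_product_univ, expect_product]
    exact expect_congr rfl fun x _ => Fintype.expect_const (F x)
  rw [h1, h2, h3]

/-- Resampling all the coordinates in `S` preserves the uniform distribution. -/
lemma expect_resample {ι A : Type*} [Fintype ι] [DecidableEq ι] [Fintype A] [Nonempty A]
    (S : ι → Prop) [DecidablePred S] (F : (ι → A) → ℝ) :
    𝔼 x : ι → A, 𝔼 y : ι → A, F (fun i => if S i then y i else x i) = 𝔼 x, F x := by
  have h1 : 𝔼 x : ι → A, 𝔼 y : ι → A, F (fun i => if S i then y i else x i)
      = 𝔼 q : (ι → A) × (ι → A), F (fun i => if S i then q.2 i else q.1 i) := by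
    rw [← univ_product_univ, expect_product]
  have h2 : 𝔼 q : (ι → A) × (ι → A), F (fun i => if S i then q.2 i else q.1 i)
      = 𝔼 q : (ι → A) × (ι → A), F q.1 := by
    refine Fintype.expect_equiv (Involutive.toPerm (fun q : (ι → A) × (ι → A) =>
      ((fun i => if S i then q.2 i else q.1 i), (fun i => if S i then q.1 i else q.2 i))) ?_)
      _ _ ?_
    · rintro ⟨x, y⟩
      ext i <;> by_cases h : S i <;> simp [h]
    · rintro ⟨x, a⟩
      rfl
  have h3 : 𝔼 q : (ι → A) × (ι → A), F q.1 = 𝔼 x, F x := by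
    rw [← univ_product_univ, expect_product]
    exact expect_congr rfl fun x _ => Fintype.expect_const (F x)
  rw [h1, h2, h3]

/-- The coordinates selected by an injective map are again uniformly distributed. -/
lemma expect_comp_injective {I J A : Type*} [Fintype I] [DecidableEq I] [Fintype J]
    [DecidableEq J] [Fintype A] [Nonempty A] {e : J → I} (he : Injective e) (F : (J → A) → ℝ) :
    𝔼 c : I → A, F (fun j => c (e j)) = 𝔼 x, F x := by
  classical
  let E1 := Equiv.piEquivPiSubtypeProd (fun i => i ∈ Set.range e) (fun _ : I => A)
  let E2 : (Set.range e → A) ≃ (J → A) := (Equiv.ofInjective e he).symm.arrowCongr (Equiv.refl A)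
  rw [Fintype.expect_equiv E1 (fun c : I → A => F (fun j => c (e j))) (fun q => F (E2 q.1))
    (fun c => rfl), ← univ_product_univ, expect_product]
  rw [Fintype.expect_equiv E2 _ F (fun c => Fintype.expect_const _)]

/-- Independent coordinates: the average of a product is the product of the averages. -/
lemma expect_prod_pi {ι A : Type*} [Fintype ι] [DecidableEq ι] [Fintype A]
    (F : ι → A → ℝ) : 𝔼 x : ι → A, ∏ i, F i (x i) = ∏ i, 𝔼 a, F i a := by
  simp only [Fintype.expect_eq_sum_div_card, prod_div_distrib, prod_univ_sum,
    Fintype.piFinset_univ]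
  simp

open Classical in
/-- The probability of `p` under the uniform distribution of a finite type. -/
def prob {X : Type*} [Fintype X] (p : X → Prop) : ℝ := 𝔼 x, if p x then (1 : ℝ) else 0

section prob
variable {X : Type*} [Fintype X]

lemma prob_nonneg (p : X → Prop) : 0 ≤ prob p :=
  expect_nonneg fun x _ => by split_ifs <;> norm_num

lemma prob_mono {p q : X → Prop} (h : ∀ x, p x → q x) : prob p ≤ prob q := by
  classical
  refine expect_le_expect fun x _ => ?_
  by_cases hp : p x
  · simp [hp, h x hp]
  · simp only [hp, if_false]
    split_ifs <;> norm_num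

lemma prob_congr {p q : X → Prop} (h : ∀ x, p x ↔ q x) : prob p = prob q := by
  rw [funext fun x => propext (h x)]

lemma prob_eq_card_div {p : X → Prop} {s : Finset X} (h : ∀ x, p x ↔ x ∈ s) :
    prob p = s.card / Fintype.card X := by
  classical
  have : prob p = 𝔼 x, if x ∈ s then (1 : ℝ) else 0 :=
    expect_congr rfl fun x _ => by simp only [h]
  rw [this, Fintype.expect_eq_sum_div_card]
  simp

lemma prob_or_add_prob_and (p q : X → Prop) :
    prob (fun x => p x ∨ q x) + prob (fun x => p x ∧ q x) = prob p + prob q := by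
  classical
  unfold prob
  rw [← expect_add_distrib, ← expect_add_distrib]
  refine expect_congr rfl fun x _ => ?_
  by_cases hp : p x <;> by_cases hq : q x <;> simp [hp, hq]

lemma prob_or_le (p q : X → Prop) : prob (fun x => p x ∨ q x) ≤ prob p + prob q := by
  linarith [prob_or_add_prob_and p q, prob_nonneg fun x => p x ∧ q x]

lemma prob_exists_le {α : Type*} (s : Finset α) (p : α → X → Prop) :
    prob (fun x => ∃ a ∈ s, p a x) ≤ ∑ a ∈ s, prob (p a) := by
  classical
  unfold prob
  rw [← expect_sum_comm]
  refine expect_le_expect fun x _ => ?_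
  split_ifs with h
  · obtain ⟨a, ha, hp⟩ := h
    refine le_trans ?_ (single_le_sum (f := fun a => if p a x then (1 : ℝ) else 0)
      (fun b _ => by split_ifs <;> norm_num) ha)
    simp [hp]
  · exact sum_nonneg fun b _ => by split_ifs <;> norm_num

/-- Markov's inequality. -/
lemma prob_le_of_le {p : X → Prop} {g : X → ℝ} (hg : ∀ x, 0 ≤ g x) (h : ∀ x, p x → 1 ≤ g x) :
    prob p ≤ 𝔼 x, g x := by
  classical
  refine expect_le_expect fun x _ => ?_
  split_ifs with hp
  · exact h x hp
  · exact hg x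

end prob

/-! ### Total influence of low degree functions -/

section influence
variable {ι A : Type*} [Fintype ι] [DecidableEq ι] [Fintype A]

/-- Averaging a function over the `i`-th coordinate. -/
def coordAvg (i : ι) : ((ι → A) → ℝ) →ₗ[ℝ] ((ι → A) → ℝ) where
  toFun g x := 𝔼 a, g (update x i a)
  map_add' g h := by
    ext x
    simp [expect_add_distrib]
  map_smul' c g := by
    ext x
    simp [mul_expect]

lemma coordAvg_apply (i : ι) (g : (ι → A) → ℝ) (x : ι → A) :
    coordAvg i g x = 𝔼 a, g (update x i a) := rfl

lemma coordAvg_update (i : ι) (g : (ι → A) → ℝ) (x : ι → A) (a : A) :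
    coordAvg i g (update x i a) = coordAvg i g x := by
  simp [coordAvg_apply]

lemma coordAvg_comm (i j : ι) (g : (ι → A) → ℝ) :
    coordAvg i (coordAvg j g) = coordAvg j (coordAvg i g) := by
  by_cases hij : i = j
  · rw [hij]
  · ext x
    simp only [coordAvg_apply]
    rw [expect_comm]
    refine expect_congr rfl fun a _ => expect_congr rfl fun b _ => ?_
    rw [update_comm hij]

variable [Nonempty A]

lemma expect_mul_coordAvg (i : ι) (u v : (ι → A) → ℝ) :
    𝔼 x, u x * coordAvg i v x = 𝔼 x, coordAvg i u x * coordAvg i v x := by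
  rw [← expect_update i]
  refine expect_congr rfl fun x _ => ?_
  simp only [coordAvg_update, ← expect_mul]
  rfl

/-- Pythagoras for the orthogonal projection `coordAvg i`. -/
lemma expect_sq_eq_coordAvg (i : ι) (u : (ι → A) → ℝ) :
    𝔼 x, u x ^ 2 = 𝔼 x, coordAvg i u x ^ 2 + 𝔼 x, (u x - coordAvg i u x) ^ 2 := by
  have h := expect_mul_coordAvg i u u
  have h2 : 𝔼 x, (u x - coordAvg i u x) ^ 2
      = 𝔼 x, u x ^ 2 - 2 * 𝔼 x, u x * coordAvg i u x + 𝔼 x, coordAvg i u x ^ 2 := by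
    rw [mul_expect, ← expect_sub_distrib, ← expect_add_distrib]
    exact expect_congr rfl fun x _ => by ring
  have h3 : 𝔼 x, coordAvg i u x * coordAvg i u x = 𝔼 x, coordAvg i u x ^ 2 :=
    expect_congr rfl fun x _ => by ring
  rw [h2, h, h3]
  ring

/-- The mean squared change under resampling the `i`-th coordinate is twice the influence. -/
lemma expect_resample_sq (i : ι) (g : (ι → A) → ℝ) :
    𝔼 x, 𝔼 a, (g x - g (update x i a)) ^ 2 = 2 * 𝔼 x, (g x - coordAvg i g x) ^ 2 := by
  have h1 : 𝔼 x, 𝔼 a, (g x - g (update x i a)) ^ 2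
      = 𝔼 x, g x ^ 2 - 2 * 𝔼 x, g x * coordAvg i g x + 𝔼 x, 𝔼 a, g (update x i a) ^ 2 := by
    rw [mul_expect, ← expect_sub_distrib, ← expect_add_distrib]
    refine expect_congr rfl fun x _ => ?_
    rw [coordAvg_apply, mul_expect, mul_expect]
    conv_rhs => rw [← Fintype.expect_const (ι := A) (g x ^ 2)]
    rw [← expect_sub_distrib, ← expect_add_distrib]
    exact expect_congr rfl fun a _ => by ring
  rw [h1, expect_update i (fun x => g x ^ 2), expect_mul_coordAvg]
  have h3 : 𝔼 x, coordAvg i g x * coordAvg i g x = 𝔼 x, coordAvg i g x ^ 2 :=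
    expect_congr rfl fun x _ => by ring
  rw [h3]
  linarith [expect_sq_eq_coordAvg i g]

lemma dependsOn_coordAvg {g : (ι → A) → ℝ} {s : Set ι} (h : DependsOn g s) (i : ι) :
    DependsOn (coordAvg i g) s := by
  intro x y hxy
  refine expect_congr rfl fun a _ => h fun j hj => ?_
  by_cases hji : j = i
  · subst hji; simp
  · simp [update_of_ne hji, hxy j hj]

lemma coordAvg_of_dependsOn {g : (ι → A) → ℝ} {s : Set ι} (h : DependsOn g s) {i : ι}
    (hi : i ∉ s) : coordAvg i g = g := by
  ext x
  rw [coordAvg_apply]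
  conv_rhs => rw [← Fintype.expect_const (ι := A) (g x)]
  refine expect_congr rfl fun a _ => h fun j hj => ?_
  rw [update_of_ne]
  rintro rfl
  exact hi hj

/-- The span of the functions that depend on at most `D` coordinates of `B`, and in an arbitrary
way on the coordinates outside `B`. -/
def lowDegree (A : Type*) (B : Finset ι) (D : ℕ) : Submodule ℝ ((ι → A) → ℝ) :=
  Submodule.span ℝ {g | ∃ S ⊆ B, S.card ≤ D ∧ DependsOn g ((S : Set ι) ∪ (B : Set ι)ᶜ)}

lemma sub_coordAvg_of_mem_lowDegree_zero {B : Finset ι} {g : (ι → A) → ℝ}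
    (hg : g ∈ lowDegree A B 0) {i : ι} (hi : i ∈ B) : g - coordAvg i g = 0 := by
  refine Submodule.span_induction (p := fun g _ => g - coordAvg i g = 0) ?_ (by simp) ?_ ?_ hg
  · rintro g ⟨S, -, hS, hd⟩
    rw [coordAvg_of_dependsOn hd, sub_self]
    simp [card_eq_zero.1 (Nat.le_zero.1 hS), hi]
  · intro u v _ _ hu hv
    rw [map_add, add_sub_add_comm, hu, hv, add_zero]
  · intro c u _ hu
    rw [map_smul, ← smul_sub, hu, smul_zero]

lemma coordAvg_mem_lowDegree {B : Finset ι} {i : ι} {D : ℕ}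
    {g : (ι → A) → ℝ} (hg : g ∈ lowDegree A (insert i B) D) :
    coordAvg i g ∈ lowDegree A B D := by
  refine Submodule.span_induction (p := fun g _ => coordAvg i g ∈ lowDegree A B D)
    ?_ (by simp) ?_ ?_ hg
  · rintro g ⟨S, hSB, hS, hd⟩
    refine Submodule.subset_span ⟨S ∩ B, inter_subset_right,
      (card_le_card inter_subset_left).trans hS, dependsOn_coordAvg (hd.mono ?_) i⟩
    intro j hj
    by_cases hjB : j ∈ B
    · simp_all
    · simp [hjB]
  · intro u v _ _ hu hv
    rw [map_add]
    exact Submodule.add_mem _ hu hv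
  · intro c u _ hu
    rw [map_smul]
    exact Submodule.smul_mem _ _ hu

/-- Removing the part of a function that does not depend on `i` lowers the degree in the other
coordinates. -/
lemma sub_coordAvg_mem_lowDegree {B : Finset ι} {i : ι} (hi : i ∉ B) {D : ℕ}
    {g : (ι → A) → ℝ} (hg : g ∈ lowDegree A (insert i B) (D + 1)) :
    g - coordAvg i g ∈ lowDegree A B D := by
  refine Submodule.span_induction (p := fun g _ => g - coordAvg i g ∈ lowDegree A B D)
    ?_ (by simp) ?_ ?_ hg
  · rintro g ⟨S, hSB, hS, hd⟩
    by_cases hiS : i ∈ S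
    · have hd' : DependsOn g ((S.erase i : Finset ι) ∪ (B : Set ι)ᶜ : Set ι) := by
        refine hd.mono ?_
        intro j hj
        by_cases hjB : j ∈ B
        · have : j ≠ i := by rintro rfl; exact hi hjB
          simp_all
        · simp [hjB]
      have : g - coordAvg i g ∈ {g : (ι → A) → ℝ | ∃ S ⊆ B, S.card ≤ D ∧
          DependsOn g ((S : Set ι) ∪ (B : Set ι)ᶜ)} := by
        refine ⟨S.erase i, ?_, by rw [card_erase_of_mem hiS]; omega, ?_⟩
        · intro j hj
          have := hSB (mem_of_mem_erase hj)
          rw [mem_erase] at hj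
          exact (mem_insert.1 this).resolve_left hj.1
        · intro x y hxy
          simp only [Pi.sub_apply]
          rw [hd' hxy, dependsOn_coordAvg hd' i hxy]
      exact Submodule.subset_span this
    · rw [coordAvg_of_dependsOn hd, sub_self]
      · exact Submodule.zero_mem _
      · simp [hiS]
  · intro u v _ _ hu hv
    rw [map_add, add_sub_add_comm]
    exact Submodule.add_mem _ hu hv
  · intro c u _ hu
    rw [map_smul, ← smul_sub]
    exact Submodule.smul_mem _ _ hu

/-- The total influence of a function of degree `D` is at most `D` times its second moment. The
degree in the coordinates `B` is peeled off one coordinate at a time. -/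
theorem total_influence_le (B : Finset ι) : ∀ (D : ℕ) (g : (ι → A) → ℝ), g ∈ lowDegree A B D →
    ∑ i ∈ B, 𝔼 x, (g x - coordAvg i g x) ^ 2 ≤ D * 𝔼 x, g x ^ 2 := by
  induction B using Finset.induction_on with
  | empty =>
    intro D g _
    simp only [sum_empty]
    exact mul_nonneg (Nat.cast_nonneg _) (expect_nonneg fun x _ => sq_nonneg _)
  | insert a B ha ih =>
    intro D g hg
    rcases D with _ | D
    · refine (sum_eq_zero fun i hi => ?_).le.trans (by simp)
      refine expect_eq_zero fun x _ => ?_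
      have := congrFun (sub_coordAvg_of_mem_lowDegree_zero hg hi) x
      simp only [Pi.sub_apply, Pi.zero_apply] at this
      rw [this]
      norm_num
    · set g1 := coordAvg a g with hg1
      set h := g - g1 with hh
      have e1 := ih (D + 1) g1 (coordAvg_mem_lowDegree hg)
      have e2 := ih D h (sub_coordAvg_mem_lowDegree ha hg)
      have key : ∀ i ∈ B, 𝔼 x, (g x - coordAvg i g x) ^ 2
          = 𝔼 x, (g1 x - coordAvg i g1 x) ^ 2 + 𝔼 x, (h x - coordAvg i h x) ^ 2 := by
        intro i _
        have := expect_sq_eq_coordAvg a (g - coordAvg i g)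
        rw [map_sub, coordAvg_comm a i] at this
        simp only [Pi.sub_apply] at this
        rw [this]
        congr 1
        refine expect_congr rfl fun x _ => ?_
        rw [hh, map_sub]
        simp only [Pi.sub_apply, hg1]
        ring
      rw [sum_insert ha, sum_congr rfl key, sum_add_distrib, expect_sq_eq_coordAvg a g]
      have e3 : 𝔼 x, (g x - coordAvg a g x) ^ 2 = 𝔼 x, h x ^ 2 := rfl
      rw [e3]
      push_cast at e1 ⊢
      nlinarith

end influence

/-- A polynomial of degree `D` in the one-hot encoding is a function of degree `D` of the
clauses. -/
lemma eval_encode_mem_lowDegree {k n m D : ℕ} (p : MvPolynomial (InputIndex k n m) ℝ)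
    (hp : p.totalDegree ≤ D) :
    (fun Φ : Formula k n m => MvPolynomial.eval (encode Φ) p)
      ∈ lowDegree (Fin k → Literal n) (univ : Finset (Fin m)) D := by
  have : (fun Φ : Formula k n m => MvPolynomial.eval (encode Φ) p)
      = ∑ d ∈ p.support, p.coeff d • fun Φ : Formula k n m => ∏ i ∈ d.support, encode Φ i ^ d i := by
    ext Φ
    rw [MvPolynomial.eval_eq]
    simp
  rw [this]
  refine Submodule.sum_mem _ fun d hd => Submodule.smul_mem _ _ (Submodule.subset_span
    ⟨d.support.image Prod.fst, subset_univ _, ?_, ?_⟩)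
  · refine card_image_le.trans (le_trans ?_ ((MvPolynomial.le_totalDegree hd).trans hp))
    rw [Finsupp.sum, card_eq_sum_ones]
    exact sum_le_sum fun i hi => Nat.one_le_iff_ne_zero.2 (Finsupp.mem_support_iff.1 hi)
  · intro Φ Ψ h
    refine prod_congr rfl fun i hi => ?_
    have := h i.1 (Or.inl (mem_coe.2 (mem_image_of_mem _ hi)))
    simp only [encode, this]

/-- The total squared change of a degree-`D` polynomial map when one clause at a time is
resampled. -/
theorem sum_expect_resample_le {k n m D : ℕ} [Nonempty (Literal n)]
    {f : (InputIndex k n m → ℝ) → EuclideanSpace ℝ (Fin n)} (hf : IsDegreePoly D f) :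
    ∑ i : Fin m, 𝔼 Φ : Formula k n m, 𝔼 C : Fin k → Literal n,
      ‖f (encode Φ) - f (encode (update Φ i C))‖ ^ 2
      ≤ 2 * D * 𝔼 Φ : Formula k n m, ‖f (encode Φ)‖ ^ 2 := by
  obtain ⟨p, hpD, hp⟩ := hf
  have h1 : ∀ j : Fin n, ∑ i : Fin m, 𝔼 Φ : Formula k n m, 𝔼 C : Fin k → Literal n,
      (f (encode Φ) j - f (encode (update Φ i C)) j) ^ 2
      ≤ 2 * D * 𝔼 Φ : Formula k n m, f (encode Φ) j ^ 2 := by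
    intro j
    have h := total_influence_le univ D _ (eval_encode_mem_lowDegree (p j) (hpD j))
    simp only [hp]
    rw [sum_congr rfl fun i _ => expect_resample_sq i
      (fun Φ : Formula k n m => MvPolynomial.eval (encode Φ) (p j)), ← mul_sum]
    linarith
  simp only [EuclideanSpace.norm_sq_eq, PiLp.sub_apply, Real.norm_eq_abs, sq_abs, expect_sum_comm]
  rw [sum_comm, mul_sum]
  exact sum_le_sum fun j _ => h1 j

/-! ### A lower bound for the probability that a resampling path has no bad step -/

lemma expect_log_le_log_expect {A : Type*} [Fintype A] [Nonempty A] {g : A → ℝ}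
    (hg : ∀ a, 0 < g a) : 𝔼 a, Real.log (g a) ≤ Real.log (𝔼 a, g a) := by
  have h := strictConcaveOn_log_Ioi.concaveOn.le_map_sum (t := (univ : Finset A))
    (w := fun _ => (Fintype.card A : ℝ)⁻¹) (p := g) (fun _ _ => by positivity)
    (by simp) (fun a _ => hg a)
  simp only [smul_eq_mul, ← mul_sum] at h
  rw [Fintype.expect_eq_sum_div_card, Fintype.expect_eq_sum_div_card, div_eq_inv_mul,
    div_eq_inv_mul]
  exact h

open Classical in
/-- Jensen's inequality along one resampling step. The resampling kernel restricted to `R` is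
compared with the kernel that stays put whenever the proposed step violates `R`: the latter is
reversible with respect to the uniform distribution, and the two differ only on the diagonal, by a
factor of at most `1 + #{b | ¬ R a b} ≤ |A|`. -/
lemma expect_log_step {A : Type*} [Fintype A] [Nonempty A] {R : A → A → Prop}
    (hsymm : ∀ a b, R a b → R b a) (hrefl : ∀ a, R a a) {φ : A → ℝ} (hφ : ∀ a, 0 < φ a) :
    𝔼 a, Real.log (φ a) - 2 * Real.log (Fintype.card A) * 𝔼 a, prob (fun b => ¬ R a b)
      ≤ 𝔼 a, Real.log (𝔼 b, if R a b then φ b else 0) := by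
  set L : ℝ := ((Fintype.card A : ℕ) : ℝ) with hL
  have hL0 : 0 < L := by rw [hL]; exact_mod_cast Fintype.card_pos
  have pt : ∀ a, 𝔼 b, (if R a b then Real.log (φ b) else Real.log (φ a))
      - 2 * Real.log L * prob (fun b => ¬ R a b)
      ≤ Real.log (𝔼 b, if R a b then φ b else 0) := by
    intro a
    set Bs : Finset A := univ.filter (fun b => ¬ R a b) with hBs
    have haB : a ∉ Bs := by simp [hBs, hrefl a]
    set B : ℝ := (Bs.card : ℝ) with hB
    have hB0 : 0 ≤ B := Nat.cast_nonneg _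
    set ψ : A → ℝ := fun b => if b ∈ insert a Bs then φ a / (1 + B) else φ b with hψ
    have hψ0 : ∀ b, 0 < ψ b := by
      intro b
      simp only [hψ]
      split_ifs
      · exact div_pos (hφ a) (by linarith)
      · exact hφ b
    have hcard : ((insert a Bs).card : ℝ) = 1 + B := by
      rw [card_insert_of_notMem haB]; push_cast; ring
    have s1 : 𝔼 b, ψ b = 𝔼 b, if R a b then φ b else 0 := by
      rw [Fintype.expect_eq_sum_div_card, Fintype.expect_eq_sum_div_card]
      congr 1
      have e1 : ∑ b, ψ b = ∑ b ∈ insert a Bs, φ a / (1 + B) + ∑ b ∈ (insert a Bs)ᶜ, φ b := by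
        rw [← sum_add_sum_compl (insert a Bs)]
        congr 1
        · exact sum_congr rfl fun b hb => by simp only [hψ, hb, if_true]
        · exact sum_congr rfl fun b hb => by
            rw [mem_compl] at hb
            simp only [hψ, hb, if_false]
      have e2 : ∑ b, (if R a b then φ b else 0) = φ a + ∑ b ∈ (insert a Bs)ᶜ, φ b := by
        rw [← sum_add_sum_compl (insert a Bs), sum_insert haB]
        have z : ∑ b ∈ Bs, (if R a b then φ b else 0) = 0 :=
          sum_eq_zero fun b hb => by simp [(mem_filter.1 hb).2]
        rw [z, if_pos (hrefl a), add_zero]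
        congr 1
        refine sum_congr rfl fun b hb => ?_
        rw [mem_compl, mem_insert, not_or] at hb
        have : R a b := by
          by_contra hc
          exact hb.2 (by simp [hBs, hc])
        simp [this]
      rw [e1, e2, sum_const, nsmul_eq_mul, hcard, mul_div_cancel₀ _ (by linarith : (1 + B) ≠ 0)]
    have s2 : 𝔼 b, (if R a b then Real.log (φ b) else Real.log (φ a))
        - (1 + B) / L * Real.log (1 + B) ≤ 𝔼 b, Real.log (ψ b) := by
      have : (1 + B) / L * Real.log (1 + B)
          = 𝔼 b, if b ∈ insert a Bs then Real.log (1 + B) else 0 := by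
        rw [Fintype.expect_eq_sum_div_card, ← sum_filter, filter_mem_eq_inter, univ_inter,
          sum_const, nsmul_eq_mul, hcard]
        ring
      rw [this, ← expect_sub_distrib]
      refine expect_le_expect fun b _ => ?_
      simp only [hψ]
      by_cases hb : b ∈ insert a Bs
      · rw [if_pos hb, if_pos hb, Real.log_div (hφ a).ne' (by linarith)]
        rcases mem_insert.1 hb with rfl | hb
        · simp [hrefl]
        · simp [(mem_filter.1 hb).2]
      · rw [if_neg hb, if_neg hb]
        rw [mem_insert, not_or] at hb
        have : R a b := by
          by_contra hc
          exact hb.2 (by simp [hBs, hc])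
        simp [this]
    have s3 : prob (fun b => ¬ R a b) = B / L := by
      exact prob_eq_card_div fun b => by simp [hBs]
    have s4 : (1 + B) / L * Real.log (1 + B) ≤ 2 * Real.log L * (B / L) := by
      rcases Nat.eq_zero_or_pos Bs.card with h0 | h0
      · simp [hB, h0]
      · have hB1 : 1 ≤ B := by rw [hB]; exact_mod_cast h0
        have hBL : 1 + B ≤ L := by
          rw [← hcard, hL]
          exact_mod_cast card_le_univ _
        have hlog : Real.log (1 + B) ≤ Real.log L := Real.log_le_log (by linarith) hBL
        have hlog0 : 0 ≤ Real.log (1 + B) := Real.log_nonneg (by linarith)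
        calc (1 + B) / L * Real.log (1 + B) ≤ (2 * B) / L * Real.log L := by
              gcongr
              linarith
          _ = _ := by ring
    have s5 := expect_log_le_log_expect hψ0
    rw [s1] at s5
    rw [s3]
    linarith
  have sw : 𝔼 a, 𝔼 b, (if R a b then Real.log (φ b) else Real.log (φ a))
      = 𝔼 a, Real.log (φ a) := by
    have e1 : ∀ a b, (if R a b then Real.log (φ b) else Real.log (φ a))
        = (if R a b then Real.log (φ b) else 0) + (Real.log (φ a)
          - if R a b then Real.log (φ a) else 0) := by
      intro a b
      split_ifs <;> ring
    simp only [e1, expect_add_distrib, expect_sub_distrib, Fintype.expect_const]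
    have e2 : 𝔼 a, 𝔼 b, (if R a b then Real.log (φ b) else 0)
        = 𝔼 a, 𝔼 b, (if R a b then Real.log (φ a) else 0) := by
      rw [expect_comm]
      refine expect_congr rfl fun a _ => expect_congr rfl fun b _ => ?_
      rw [show R b a ↔ R a b from ⟨hsymm _ _, hsymm _ _⟩]
    rw [e2]
    ring
  have := expect_le_expect (s := univ) fun a _ => pt a
  rw [expect_sub_distrib, sw, ← mul_expect] at this
  exact this

open Classical in
/-- The same for the resampling of one coordinate of a product space. -/
lemma expect_log_update {J A : Type*} [Fintype J] [DecidableEq J] [Fintype A] [Nonempty A]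
    {R : (J → A) → (J → A) → Prop} (hsymm : ∀ x y, R x y → R y x) (hrefl : ∀ x, R x x)
    {φ : (J → A) → ℝ} (hφ : ∀ x, 0 < φ x) (i : J) :
    𝔼 x, Real.log (φ x)
        - 2 * Real.log (Fintype.card A) * 𝔼 x, prob (fun b => ¬ R x (update x i b))
      ≤ 𝔼 x, Real.log (𝔼 b, if R x (update x i b) then φ (update x i b) else 0) := by
  rw [← expect_update i (fun x => Real.log (φ x)),
    ← expect_update i (fun x => prob (fun b => ¬ R x (update x i b))),
    ← expect_update i (fun x => Real.log (𝔼 b, if R x (update x i b) then φ (update x i b) else 0)),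
    mul_expect, ← expect_sub_distrib]
  refine expect_le_expect fun x _ => ?_
  simp only [update_idem]
  exact expect_log_step (R := fun a b => R (update x i a) (update x i b))
    (fun a b => hsymm _ _) (fun a => hrefl _) (fun a => hφ _)

open Classical in
/-- `e t` lists the coordinates of the sequence `c` that are used at time `t`; each step replaces
one of them by a coordinate `j t` that was not used before. -/
lemma expect_path_ge {I J A : Type*} [Fintype I] [DecidableEq I] [Fintype J]
    [DecidableEq J] [Fintype A] [Nonempty A] {e : ℕ → J → I} (he : Injective (e 0))
    {i : ℕ → J} {j : ℕ → I} {R : (J → A) → (J → A) → Prop} (hsymm : ∀ x y, R x y → R y x)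
    (hrefl : ∀ x, R x x) (T : ℕ) (hstep : ∀ t < T, e (t + 1) = update (e t) (i t) (j t))
    (hfresh : ∀ t < T, ∀ s ≤ t, ∀ l, e s l ≠ j t) {φ : (J → A) → ℝ} (hφ : ∀ x, 0 < φ x) :
    Real.exp (𝔼 x, Real.log (φ x) - 2 * Real.log (Fintype.card A)
        * ∑ t ∈ range T, 𝔼 x, prob (fun b => ¬ R x (update x (i t) b)))
      ≤ 𝔼 c : I → A, if (∀ t < T, R (fun l => c (e t l)) (fun l => c (e (t + 1) l)))
          then φ (fun l => c (e T l)) else 0 := by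
  induction T generalizing φ with
  | zero =>
    simp only [range_zero, sum_empty, mul_zero, sub_zero, not_lt_zero, false_imp_iff,
      implies_true, if_true]
    rw [expect_comp_injective he φ]
    refine (Real.exp_le_exp.2 (expect_log_le_log_expect hφ)).trans (Real.exp_log ?_).le
    exact expect_pos (fun x _ => hφ x) univ_nonempty
  | succ T ih =>
    set φ' : (J → A) → ℝ :=
      fun x => 𝔼 b, if R x (update x (i T) b) then φ (update x (i T) b) else 0 with hφ'
    have hφ'0 : ∀ x, 0 < φ' x := by
      intro x
      refine expect_pos' (fun b _ => ?_) ⟨x (i T), mem_univ _, ?_⟩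
      · split_ifs
        · exact (hφ _).le
        · exact le_rfl
      · simp [hrefl, hφ]
    have h1 := ih (fun t ht => hstep t (ht.trans (Nat.lt_succ_self T)))
      (fun t ht => hfresh t (ht.trans (Nat.lt_succ_self T))) hφ'0
    have h2 := expect_log_update hsymm hrefl hφ (i T)
    have h3 : 𝔼 c : I → A, (if (∀ t < T + 1, R (fun l => c (e t l)) (fun l => c (e (t + 1) l)))
          then φ (fun l => c (e (T + 1) l)) else 0)
        = 𝔼 c : I → A, if (∀ t < T, R (fun l => c (e t l)) (fun l => c (e (t + 1) l)))
          then φ' (fun l => c (e T l)) else 0 := by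
      rw [← expect_update (j T)]
      refine expect_congr rfl fun c _ => ?_
      have u1 : ∀ (a : A) (s : ℕ), s ≤ T →
          (fun l => update c (j T) a (e s l)) = fun l => c (e s l) := by
        intro a s hs
        ext l
        rw [update_of_ne (hfresh T (Nat.lt_succ_self T) s hs l)]
      have u2 : ∀ a : A, (fun l => update c (j T) a (e (T + 1) l))
          = update (fun l => c (e T l)) (i T) a := by
        intro a
        ext l
        rw [hstep T (Nat.lt_succ_self T)]
        by_cases hl : l = i T
        · subst hl; simp
        · rw [update_of_ne hl, update_of_ne hl, update_of_ne (hfresh T (Nat.lt_succ_self T) T le_rfl l)]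
      have u3 : ∀ a : A, (∀ t < T + 1, R (fun l => update c (j T) a (e t l))
            (fun l => update c (j T) a (e (t + 1) l)))
          ↔ (∀ t < T, R (fun l => c (e t l)) (fun l => c (e (t + 1) l))) ∧
            R (fun l => c (e T l)) (update (fun l => c (e T l)) (i T) a) := by
        intro a
        rw [Nat.forall_lt_succ_right, u1 a T le_rfl, u2 a]
        refine and_congr_left fun _ => forall_congr' fun t => forall_congr' fun ht => ?_
        rw [u1 a t ht.le, u1 a (t + 1) ht]
      simp only [u3, u2]
      by_cases hall : ∀ t < T, R (fun l => c (e t l)) (fun l => c (e (t + 1) l))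
      · rw [if_pos hall]
        refine expect_congr rfl fun b _ => if_congr ?_ rfl rfl
        exact and_iff_right hall
      · simp only [hall, false_and, if_false, Fintype.expect_const]
    rw [h3]
    refine le_trans (Real.exp_le_exp.2 ?_) h1
    rw [sum_range_succ, mul_add]
    linarith

/-- The probability that a path of successive resamplings has no step violating `R`. -/
theorem prob_path_ge {I J A : Type*} [Fintype I] [DecidableEq I] [Fintype J]
    [DecidableEq J] [Fintype A] [Nonempty A] {e : ℕ → J → I} (he : Injective (e 0))
    {i : ℕ → J} {j : ℕ → I} {R : (J → A) → (J → A) → Prop} (hsymm : ∀ x y, R x y → R y x)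
    (hrefl : ∀ x, R x x) (T : ℕ) (hstep : ∀ t < T, e (t + 1) = update (e t) (i t) (j t))
    (hfresh : ∀ t < T, ∀ s ≤ t, ∀ l, e s l ≠ j t) :
    Real.exp (-(2 * Real.log (Fintype.card A)
        * ∑ t ∈ range T, 𝔼 x, prob (fun b => ¬ R x (update x (i t) b))))
      ≤ prob (fun c : I → A => ∀ t < T, R (fun l => c (e t l)) (fun l => c (e (t + 1) l))) := by
  have := expect_path_ge he hsymm hrefl T hstep hfresh (φ := fun _ => 1) (fun _ => one_pos)
  simp only [Real.log_one, expect_const_zero, zero_sub] at this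
  refine this.trans (le_of_eq ?_)
  unfold prob
  refine expect_congr rfl fun c _ => ?_
  congr

/-! ### Conditional entropy of a Boolean word given a labelling -/

section entropy
variable {I P : Type*} [Fintype I] [DecidableEq P]

/-- The fraction of the indices with the same label as `i` at which the word `y` has the value `b`:
the empirical conditional probability of `b` given the label of `i`. -/
def condFreq (S : I → P) (y : I → Bool) (i : I) (b : Bool) : ℝ :=
  ((univ.filter fun i' => S i' = S i ∧ y i' = b).card : ℝ) / (univ.filter fun i' => S i' = S i).card

/-- The information `-log (condFreq S y i (y i))` of the value of `y` at `i`, given the label. -/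
def info (S : I → P) (y : I → Bool) (i : I) : ℝ := -Real.log (condFreq S y i (y i))

/-- The empirical conditional entropy `H(y_i | S_i)`, with `i` uniformly distributed. -/
def condEnt (S : I → P) (y : I → Bool) : ℝ := 𝔼 i, info S y i

lemma condFreq_nonneg (S : I → P) (y : I → Bool) (i : I) (b : Bool) : 0 ≤ condFreq S y i b := by
  unfold condFreq; positivity

lemma card_label_pos (S : I → P) (i : I) : 0 < (univ.filter fun i' => S i' = S i).card :=
  card_pos.2 ⟨i, by simp⟩

lemma condFreq_self_pos (S : I → P) (y : I → Bool) (i : I) : 0 < condFreq S y i (y i) := by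
  have h1 : 0 < (univ.filter fun i' => S i' = S i ∧ y i' = y i).card := card_pos.2 ⟨i, by simp⟩
  have h2 := card_label_pos S i
  unfold condFreq
  positivity

lemma condFreq_le_one (S : I → P) (y : I → Bool) (i : I) (b : Bool) : condFreq S y i b ≤ 1 := by
  unfold condFreq
  refine div_le_one_of_le₀ ?_ (Nat.cast_nonneg _)
  exact_mod_cast card_le_card fun i' hi' => by simp_all

lemma condFreq_add (S : I → P) (y : I → Bool) (i : I) :
    condFreq S y i true + condFreq S y i false = 1 := by
  have h2 : ((univ.filter fun i' => S i' = S i).card : ℝ) ≠ 0 := by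
    exact_mod_cast (card_label_pos S i).ne'
  unfold condFreq
  rw [← add_div, div_eq_one_iff_eq h2]
  have := card_filter_add_card_filter_not (s := univ.filter fun i' => S i' = S i)
    (fun i' => y i' = true)
  rw [filter_filter, filter_filter] at this
  simp only [Bool.not_eq_true] at this
  exact_mod_cast this

lemma condFreq_congr {S : I → P} (y : I → Bool) {i i' : I} (h : S i = S i') :
    condFreq S y i = condFreq S y i' := by
  ext b
  simp only [condFreq, h]

lemma info_nonneg (S : I → P) (y : I → Bool) (i : I) : 0 ≤ info S y i := by
  have := Real.log_nonpos (condFreq_nonneg S y i (y i)) (condFreq_le_one S y i (y i))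
  unfold info
  linarith

lemma exp_neg_info (S : I → P) (y : I → Bool) (i : I) :
    Real.exp (-info S y i) = condFreq S y i (y i) := by
  rw [info, neg_neg, Real.exp_log (condFreq_self_pos S y i)]

/-- A word that is constant on the labels has no conditional entropy. -/
lemma condEnt_eq_zero {S : I → P} {y : I → Bool} (h : ∀ i i', S i = S i' → y i = y i') :
    condEnt S y = 0 := by
  refine expect_eq_zero fun i _ => ?_
  have h2 : ((univ.filter fun i' => S i' = S i).card : ℝ) ≠ 0 := by
    exact_mod_cast (card_label_pos S i).ne'
  have : condFreq S y i (y i) = 1 := by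
    unfold condFreq
    rw [div_eq_one_iff_eq h2]
    congr 2
    ext i'
    simpa using h i' i
  rw [info, this, Real.log_one, neg_zero]

lemma natCast_mul_div_le {a : ℝ} (ha : 0 ≤ a) (n : ℕ) : (n : ℝ) * (a / n) ≤ a := by
  rcases Nat.eq_zero_or_pos n with rfl | hn
  · simpa using ha
  · rw [mul_div_cancel₀ _ (by positivity)]

/-- The basic inequality of information theory: for conditional (sub)probabilities `θ`, the average
of `θ / condFreq` along the word is at most `1`. -/
lemma expect_mul_exp_info_le {S : I → P} (y : I → Bool) {θ : I → Bool → ℝ}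
    (h0 : ∀ i b, 0 ≤ θ i b) (h1 : ∀ i, θ i true + θ i false ≤ 1)
    (hS : ∀ i i', S i = S i' → θ i = θ i') :
    𝔼 i, θ i (y i) * Real.exp (info S y i) ≤ 1 := by
  have hW : ∀ i, Real.exp (info S y i) = ∑ i', if S i' = S i then
      1 / ((univ.filter fun i' => S i' = S i ∧ y i' = y i).card : ℝ) else 0 := by
    intro i
    rw [info, Real.exp_neg, Real.exp_log (condFreq_self_pos S y i), ← sum_filter, sum_const,
      nsmul_eq_mul, condFreq, inv_div, mul_one_div]
  have hsum : ∑ i, θ i (y i) * Real.exp (info S y i) ≤ Fintype.card I := by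
    simp only [hW, mul_sum]
    rw [sum_comm, Fintype.card, card_eq_sum_ones, Nat.cast_sum, Nat.cast_one]
    refine sum_le_sum fun i' _ => (le_trans ?_ (h1 i'))
    have e : ∀ i, (θ i (y i) * if S i' = S i then
        1 / ((univ.filter fun i' => S i' = S i ∧ y i' = y i).card : ℝ) else 0)
        = (if S i = S i' ∧ y i = true then
          θ i' true / ((univ.filter fun j => S j = S i' ∧ y j = true).card : ℝ) else 0)
        + (if S i = S i' ∧ y i = false then
          θ i' false / ((univ.filter fun j => S j = S i' ∧ y j = false).card : ℝ) else 0) := by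
      intro i
      by_cases h : S i = S i'
      · rw [hS i i' h, h]
        cases hy : y i <;> simp [div_eq_mul_inv]
      · have h' : ¬ S i' = S i := fun h' => h h'.symm
        simp [h, h']
    rw [sum_congr rfl fun i _ => e i, sum_add_distrib, ← sum_filter, ← sum_filter, sum_const,
      sum_const, nsmul_eq_mul, nsmul_eq_mul]
    gcongr
    · exact natCast_mul_div_le (h0 _ _) _
    · exact natCast_mul_div_le (h0 _ _) _
  rw [Fintype.expect_eq_sum_div_card]
  exact div_le_one_of_le₀ hsum (Nat.cast_nonneg _)

/-- Gibbs' inequality. -/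
lemma condEnt_le_of_subprob [Nonempty I] {S : I → P} (y : I → Bool) {θ : I → Bool → ℝ}
    (h0 : ∀ i b, 0 ≤ θ i b) (h1 : ∀ i, θ i true + θ i false ≤ 1)
    (hS : ∀ i i', S i = S i' → θ i = θ i') (hpos : ∀ i, 0 < θ i (y i)) :
    condEnt S y ≤ 𝔼 i, -Real.log (θ i (y i)) := by
  have h := expect_mul_exp_info_le y h0 h1 hS
  have h2 : 𝔼 i, (Real.log (θ i (y i)) + info S y i)
      ≤ 𝔼 i, (θ i (y i) * Real.exp (info S y i) - 1) := by
    refine expect_le_expect fun i _ => ?_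
    have := Real.log_le_sub_one_of_pos (mul_pos (hpos i) (Real.exp_pos (info S y i)))
    rwa [Real.log_mul (hpos i).ne' (Real.exp_pos _).ne', Real.log_exp] at this
  rw [expect_sub_distrib, expect_add_distrib, Fintype.expect_const] at h2
  rw [expect_neg_distrib]
  unfold condEnt
  linarith

/-- Words that differ in a fraction at most `ε` of the indices have nearly the same conditional
entropy. This is Gibbs' inequality for the conditional probabilities of `y` with noise `ε`. -/
lemma condEnt_le_add [Nonempty I] (S : I → P) {y y' : I → Bool} {ε : ℝ} (hε : 0 < ε)
    (hε1 : ε < 1) (hd : ((univ.filter fun i => y' i ≠ y i).card : ℝ) ≤ ε * Fintype.card I) :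
    condEnt S y' ≤ condEnt S y + (-Real.log (1 - ε) - ε * Real.log ε) := by
  set θ : I → Bool → ℝ := fun i b => (1 - ε) * condFreq S y i b + ε * condFreq S y i (!b) with hθ
  have hlow : ∀ i, (if y' i = y i then 1 - ε else ε) * condFreq S y i (y i) ≤ θ i (y' i) := by
    intro i
    have a1 := condFreq_nonneg S y i (y' i)
    have a2 := condFreq_nonneg S y i (!(y' i))
    simp only [hθ]
    split_ifs with h
    · rw [← h]
      nlinarith
    · have : y i = !(y' i) := by cases h1 : y i <;> cases h2 : y' i <;> simp_all
      rw [this]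
      nlinarith
  have hlowpos : ∀ i, 0 < (if y' i = y i then 1 - ε else ε) * condFreq S y i (y i) := by
    intro i
    refine mul_pos ?_ (condFreq_self_pos S y i)
    split_ifs <;> linarith
  have hG := condEnt_le_of_subprob (S := S) y' (θ := θ)
    (fun i b => by
      have a1 := condFreq_nonneg S y i b
      have a2 := condFreq_nonneg S y i (!b)
      have a3 : 0 ≤ 1 - ε := by linarith
      simp only [hθ]
      positivity)
    (fun i => by
      have := condFreq_add S y i
      simp only [hθ, Bool.not_true, Bool.not_false]
      linear_combination this)
    (fun i i' h => by simp only [hθ, condFreq_congr y h])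
    (fun i => (hlowpos i).trans_le (hlow i))
  refine hG.trans ?_
  have h2 : 𝔼 i, -Real.log (θ i (y' i))
      ≤ 𝔼 i, (info S y i + (-Real.log (1 - ε) + (if y' i ≠ y i then 1 else 0) * -Real.log ε)) := by
    refine expect_le_expect fun i _ => ?_
    have h3 := Real.log_le_log (hlowpos i) (hlow i)
    have h4 : Real.log (1 - ε) ≤ 0 := Real.log_nonpos (by linarith) (by linarith)
    rw [Real.log_mul (by split_ifs <;> linarith) (condFreq_self_pos S y i).ne'] at h3
    unfold info
    by_cases h : y' i = y i
    · simp only [h, if_true, ne_eq, not_true, if_false] at h3 ⊢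
      linarith
    · simp only [h, if_false, ne_eq, not_false_eq_true, if_true] at h3 ⊢
      linarith
  refine h2.trans ?_
  have h4 : 𝔼 i, (if y' i ≠ y i then (1 : ℝ) else 0)
      = ((univ.filter fun i => y' i ≠ y i).card : ℝ) / Fintype.card I := by
    rw [Fintype.expect_eq_sum_div_card, sum_boole]
  rw [expect_add_distrib, expect_add_distrib, Fintype.expect_const, ← expect_mul, h4]
  have hI : (0 : ℝ) < Fintype.card I := by exact_mod_cast Fintype.card_pos
  have h5 : ((univ.filter fun i => y' i ≠ y i).card : ℝ) / Fintype.card I ≤ ε := by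
    rwa [div_le_iff₀ hI]
  have h6 : 0 ≤ -Real.log ε := by linarith [Real.log_nonpos hε.le hε1.le]
  have h7 := mul_le_mul_of_nonneg_right h5 h6
  unfold condEnt
  linarith

/-- The number of words of conditional entropy at most `h`: words with the same counts of `true` on
every label have the same conditional frequencies, so each of them has probability at least
`exp (-h |I|)` under the product of these frequencies. -/
lemma card_condEnt_le [DecidableEq I] [Nonempty I] (S : I → P) (h : ℝ) :
    ((univ.filter fun y : I → Bool => condEnt S y ≤ h).card : ℝ)
      ≤ (Fintype.card I + 1 : ℝ) ^ (univ.image S).card * Real.exp (Fintype.card I * h) := by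
  classical
  set N := Fintype.card I with hN
  have hN0 : (0 : ℝ) < N := by rw [hN]; exact_mod_cast Fintype.card_pos
  let prof : (I → Bool) → ({p // p ∈ univ.image S} → Fin (N + 1)) := fun y s =>
    ⟨(univ.filter fun i => S i = s ∧ y i = true).card, Nat.lt_succ_of_le (card_le_univ _)⟩
  have fiber : ∀ f ∈ (univ : Finset ({p // p ∈ univ.image S} → Fin (N + 1))),
      ((univ.filter fun y : I → Bool => condEnt S y ≤ h).filter fun y => prof y = f).card
        ≤ ⌊Real.exp (N * h)⌋₊ := by
    intro f _
    refine Nat.le_floor ?_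
    set F := (univ.filter fun y : I → Bool => condEnt S y ≤ h).filter fun y => prof y = f with hF
    rcases F.eq_empty_or_nonempty with h0 | ⟨y0, hy0⟩
    · rw [h0]; simp; positivity
    have hq : ∀ y ∈ F, ∀ i b, condFreq S y i b = condFreq S y0 i b := by
      intro y hy i b
      have e : prof y = prof y0 := (mem_filter.1 hy).2.trans (mem_filter.1 hy0).2.symm
      have e1 := congrFun e ⟨S i, mem_image_of_mem _ (mem_univ _)⟩
      have e2 : (univ.filter fun i' => S i' = S i ∧ y i' = true).card
          = (univ.filter fun i' => S i' = S i ∧ y0 i' = true).card := Fin.ext_iff.1 e1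
      have e3 : condFreq S y i true = condFreq S y0 i true := by unfold condFreq; rw [e2]
      cases b
      · linarith [condFreq_add S y i, condFreq_add S y0 i]
      · exact e3
    have tot : ∑ y : I → Bool, ∏ i, condFreq S y0 i (y i) = 1 := by
      have := prod_univ_sum (fun _ : I => (univ : Finset Bool)) (fun i b => condFreq S y0 i b)
      rw [Fintype.piFinset_univ] at this
      rw [← this]
      refine prod_eq_one fun i _ => ?_
      rw [Fintype.sum_bool, condFreq_add]
    have each : ∀ y ∈ F, Real.exp (-(N * h)) ≤ ∏ i, condFreq S y0 i (y i) := by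
      intro y hy
      have hle : condEnt S y ≤ h := (mem_filter.1 (mem_filter.1 hy).1).2
      rw [condEnt, Fintype.expect_eq_sum_div_card, div_le_iff₀ hN0] at hle
      have : ∏ i, condFreq S y0 i (y i) = Real.exp (-∑ i, info S y i) := by
        rw [← sum_neg_distrib, Real.exp_sum]
        exact prod_congr rfl fun i _ => by rw [exp_neg_info, hq y hy]
      rw [this, Real.exp_le_exp]
      linarith
    have hs : (F.card : ℝ) * Real.exp (-(N * h)) ≤ 1 := by
      rw [← tot, ← nsmul_eq_mul]
      refine (card_nsmul_le_sum _ _ _ each).trans ?_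
      exact sum_le_sum_of_subset_of_nonneg (subset_univ _) fun y _ _ =>
        prod_nonneg fun i _ => condFreq_nonneg _ _ _ _
    rwa [Real.exp_neg, ← div_eq_mul_inv, div_le_one (Real.exp_pos _)] at hs
  have hc := card_le_mul_card_image_of_maps_to (s := univ.filter fun y : I → Bool => condEnt S y ≤ h)
    (f := prof) (fun _ _ => mem_univ _) _ fiber
  calc ((univ.filter fun y : I → Bool => condEnt S y ≤ h).card : ℝ)
      ≤ ⌊Real.exp (N * h)⌋₊ * ((N : ℝ) + 1) ^ (univ.image S).card := by
        refine (Nat.cast_le.2 hc).trans (le_of_eq ?_)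
        rw [card_univ, Fintype.card_fun, Fintype.card_fin, Fintype.card_coe]
        push_cast
        ring
    _ ≤ Real.exp (N * h) * ((N : ℝ) + 1) ^ (univ.image S).card := by
        gcongr
        exact Nat.floor_le (Real.exp_pos _).le
    _ = _ := mul_comm _ _

lemma exp_neg_mul_le_chord {x w l : ℝ} (hx : 0 ≤ x) (hxw : x ≤ w) (hw : 0 < w) :
    Real.exp (-(l * x)) ≤ 1 - x / w * (1 - Real.exp (-(l * w))) := by
  have h := convexOn_exp.2 (Set.mem_univ (0 : ℝ)) (Set.mem_univ (-(l * w)))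
    (show 0 ≤ 1 - x / w by rw [sub_nonneg, div_le_one hw]; exact hxw)
    (show 0 ≤ x / w by positivity) (by ring)
  simp only [smul_eq_mul, mul_zero, zero_add, Real.exp_zero, mul_one] at h
  have e : x / w * -(l * w) = -(l * x) := by field_simp
  rw [e] at h
  linarith

/-- The Laplace transform of the information density. The information is truncated at `w`, which
costs at most `2 exp (-w)` in the mean. -/
lemma expect_exp_neg_info_le [Nonempty I] (S : I → P) (y : I → Bool) {w z : ℝ} (hw : 0 < w)
    (hz : 1 ≤ z) :
    𝔼 i, Real.exp (-(Real.log z / w * info S y i))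
      ≤ 1 - (1 - z⁻¹) / w * (condEnt S y - 2 * Real.exp (-w)) := by
  have hz0 : 0 < z := by linarith
  have hl : 0 ≤ Real.log z / w := div_nonneg (Real.log_nonneg hz) hw.le
  have hzi : 0 ≤ (1 - z⁻¹) / w := div_nonneg (sub_nonneg.2 (inv_le_one_of_one_le₀ hz)) hw.le
  have h1 : ∀ i, Real.exp (-(Real.log z / w * info S y i))
      ≤ 1 - (1 - z⁻¹) / w * (info S y i - Real.exp (-w) * Real.exp (info S y i)) := by
    intro i
    set W := info S y i
    have hW : 0 ≤ W := info_nonneg S y i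
    have a1 : Real.exp (-(Real.log z / w * W)) ≤ Real.exp (-(Real.log z / w * min W w)) := by
      rw [Real.exp_le_exp, neg_le_neg_iff]
      exact mul_le_mul_of_nonneg_left (min_le_left _ _) hl
    have a2 := exp_neg_mul_le_chord (l := Real.log z / w) (le_min hW hw.le) (min_le_right W w) hw
    rw [div_mul_cancel₀ _ hw.ne', Real.exp_neg (Real.log z), Real.exp_log hz0] at a2
    have a3 : W - Real.exp (-w) * Real.exp W ≤ min W w := by
      rw [← Real.exp_add]
      have b1 := Real.exp_pos (-w + W)
      have b2 := Real.add_one_le_exp (-w + W)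
      refine le_min ?_ ?_ <;> linarith
    have a4 := mul_le_mul_of_nonneg_left a3 hzi
    have a5 : min W w / w * (1 - z⁻¹) = (1 - z⁻¹) / w * min W w := by ring
    linarith
  refine (expect_le_expect fun i _ => h1 i).trans ?_
  rw [expect_sub_distrib, Fintype.expect_const, ← mul_expect, expect_sub_distrib, ← mul_expect]
  have h2 := expect_mul_exp_info_le (S := S) y (θ := fun _ _ => 1 / 2) (fun _ _ => by norm_num)
    (fun _ => by norm_num) (fun _ _ _ => rfl)
  rw [← mul_expect] at h2
  have h3 : Real.exp (-w) * 𝔼 i, Real.exp (info S y i) ≤ 2 * Real.exp (-w) := by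
    nlinarith [Real.exp_pos (-w)]
  have h4 : condEnt S y - 2 * Real.exp (-w)
      ≤ 𝔼 i, info S y i - Real.exp (-w) * 𝔼 i, Real.exp (info S y i) := by
    unfold condEnt
    linarith
  linarith [mul_le_mul_of_nonneg_left h4 hzi]

/-- The probability that some word of `s` agrees with `y` at `k` random indices. Every word of `s`
is a function of the label, so when the total information of `y` along the indices exceeds `w`,
each of them agrees with probability at most `exp (-w)`. That the total information is at most `w`
is a lower tail event, treated by Chernoff's bound. -/
theorem prob_exists_agree_le [DecidableEq I] [Nonempty I] {S : I → P} (y : I → Bool) (k : ℕ)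
    (s : Finset (I → Bool)) (hs : ∀ u ∈ s, ∀ i i', S i = S i' → u i = u i') {w z : ℝ} (hw : 0 < w)
    (hz : 1 ≤ z) :
    prob (fun v : Fin k → I => ∃ u ∈ s, ∀ r, u (v r) = y (v r))
      ≤ z * Real.exp (-(k * ((1 - z⁻¹) / w) * (condEnt S y - 2 * Real.exp (-w))))
        + s.card * Real.exp (-w) := by
  classical
  have hz0 : 0 < z := by linarith
  have hl : 0 ≤ Real.log z / w := div_nonneg (Real.log_nonneg hz) hw.le
  set l := Real.log z / w
  set g1 : I → ℝ := fun i => Real.exp (-(l * info S y i)) with hg1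
  set g2 : (I → Bool) → I → ℝ :=
    fun u i => (if u i = y i then 1 else 0) * Real.exp (info S y i) with hg2
  have hg2n : ∀ u i, 0 ≤ g2 u i := fun u i => by simp only [hg2]; positivity
  have hM := prob_le_of_le (p := fun v : Fin k → I => ∃ u ∈ s, ∀ r, u (v r) = y (v r))
    (g := fun v => z * ∏ r, g1 (v r) + Real.exp (-w) * ∑ u ∈ s, ∏ r, g2 u (v r))
    (fun v => add_nonneg (mul_nonneg hz0.le (prod_nonneg fun _ _ => (Real.exp_pos _).le))
      (mul_nonneg (Real.exp_pos _).le (sum_nonneg fun u _ => prod_nonneg fun _ _ => hg2n _ _)))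
    (by
      rintro v ⟨u, hu, hv⟩
      have e1 : z * ∏ r, g1 (v r) = Real.exp (l * (w - ∑ r, info S y (v r))) := by
        rw [hg1, ← Real.exp_sum]
        conv_lhs => rw [← Real.exp_log hz0]
        rw [← Real.exp_add, sum_neg_distrib, ← mul_sum]
        congr 1
        have : l * w = Real.log z := div_mul_cancel₀ _ hw.ne'
        rw [mul_sub, this]
        ring
      have e2 : ∏ r, g2 u (v r) = Real.exp (∑ r, info S y (v r)) := by
        rw [Real.exp_sum]
        exact prod_congr rfl fun r _ => by simp [hg2, hv r]
      have p1 : 0 ≤ z * ∏ r, g1 (v r) := by rw [e1]; positivity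
      by_cases hc : ∑ r, info S y (v r) ≤ w
      · have : 1 ≤ z * ∏ r, g1 (v r) := by
          rw [e1]
          exact Real.one_le_exp (mul_nonneg hl (by linarith))
        have : 0 ≤ Real.exp (-w) * ∑ u ∈ s, ∏ r, g2 u (v r) :=
          mul_nonneg (Real.exp_pos _).le (sum_nonneg fun u _ => prod_nonneg fun _ _ => hg2n _ _)
        linarith
      · have h3 : ∏ r, g2 u (v r) ≤ ∑ u ∈ s, ∏ r, g2 u (v r) :=
          single_le_sum (f := fun u => ∏ r, g2 u (v r))
            (fun u _ => prod_nonneg fun _ _ => hg2n _ _) hu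
        have h4 := mul_le_mul_of_nonneg_left h3 (Real.exp_pos (-w)).le
        rw [e2, ← Real.exp_add] at h4
        have : 1 ≤ Real.exp (-w + ∑ r, info S y (v r)) := Real.one_le_exp (by linarith)
        linarith)
  refine hM.trans ?_
  rw [expect_add_distrib, ← mul_expect, ← mul_expect, expect_sum_comm,
    expect_prod_pi (fun _ => g1)]
  refine add_le_add (mul_le_mul_of_nonneg_left ?_ hz0.le) ?_
  · rw [prod_const, card_univ, Fintype.card_fin]
    have h := expect_exp_neg_info_le S y hw hz
    have h' := h.trans (Real.one_sub_le_exp_neg _)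
    refine (pow_le_pow_left₀ (expect_nonneg fun i _ => (Real.exp_pos _).le) h' k).trans ?_
    rw [← Real.exp_nat_mul]
    refine le_of_eq ?_
    congr 1
    ring
  · rw [mul_comm]
    refine mul_le_mul_of_nonneg_right ?_ (Real.exp_pos _).le
    rw [card_eq_sum_ones, Nat.cast_sum, Nat.cast_one]
    refine sum_le_sum fun u hu => ?_
    rw [expect_prod_pi (fun _ => g2 u)]
    refine prod_le_one (fun r _ => expect_nonneg fun i _ => hg2n u i) fun r _ => ?_
    refine expect_mul_exp_info_le y (θ := fun i b => if u i = b then 1 else 0)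
      (fun i b => by split_ifs <;> norm_num) (fun i => ?_) (fun i i' h => ?_)
    · cases u i <;> simp
    · rw [hs u hu i i' h]

end entropy

/-! ### Violating a random clause -/

/-- A clause of size `k`. -/
abbrev Clause (k n : ℕ) : Type := Fin k → Literal n

lemma not_satisfiesClause_iff {k n : ℕ} (y : Fin n → Bool) (C : Clause k n) :
    ¬ SatisfiesClause y C ↔ ∀ r, y (C r).1 ≠ (C r).2 := by
  simp [SatisfiesClause]

section clause
variable {k n : ℕ}

open Classical in
/-- Given that `y` violates a random clause, the variables of the clause are still uniformly
distributed. -/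
lemma expect_not_satisfies_mul (y : Fin n → Bool) (g : (Fin k → Fin n) → ℝ) :
    𝔼 C : Clause k n, (if ¬ SatisfiesClause y C then 1 else 0) * g (fun r => (C r).1)
      = (1 / 2) ^ k * 𝔼 v, g v := by
  rw [Fintype.expect_equiv (Equiv.arrowProdEquivProdArrow (Fin k) (fun _ => Fin n) (fun _ => Bool))
    (fun C : Clause k n => (if ¬ SatisfiesClause y C then 1 else 0) * g (fun r => (C r).1))
    (fun q => (if ∀ r, y (q.1 r) ≠ q.2 r then 1 else 0) * g q.1) (fun C =>
      congrArg₂ (· * ·) (if_congr (not_satisfiesClause_iff y C) rfl rfl) rfl),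
    ← univ_product_univ, expect_product, mul_expect]
  refine expect_congr rfl fun v _ => ?_
  dsimp only
  rw [← expect_mul]
  congr 1
  have h := expect_prod_pi (fun (r : Fin k) (b : Bool) => if y (v r) ≠ b then (1 : ℝ) else 0)
  have h2 : ∀ r, 𝔼 b : Bool, (if y (v r) ≠ b then (1 : ℝ) else 0) = 1 / 2 := by
    intro r
    rw [Fintype.expect_eq_sum_div_card, Fintype.sum_bool, Fintype.card_bool]
    cases y (v r) <;> norm_num
  rw [prod_congr rfl fun r _ => h2 r, prod_const, card_univ, Fintype.card_fin] at h
  rw [← h]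
  refine expect_congr rfl fun b _ => ?_
  by_cases hb : ∀ r, y (v r) ≠ b r
  · rw [if_pos hb, prod_eq_one fun r _ => if_pos (hb r)]
  · rw [if_neg hb]
    push Not at hb
    obtain ⟨r, hr⟩ := hb
    rw [prod_eq_zero (mem_univ r)]
    simp [hr]

lemma prob_not_satisfies [NeZero n] (y : Fin n → Bool) :
    prob (fun C : Clause k n => ¬ SatisfiesClause y C) = (1 / 2) ^ k := by
  have := expect_not_satisfies_mul (k := k) y (fun _ => 1)
  rw [Fintype.expect_const, mul_one] at this
  rw [← this]
  exact expect_congr rfl fun C _ => by rw [mul_one]; congr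

/-- If `y` violates the clause, so does `u` iff it agrees with `y` at all the variables. -/
lemma prob_not_satisfies_and_le (y : Fin n → Bool) (s : Finset (Fin n → Bool)) :
    prob (fun C : Clause k n => ¬ SatisfiesClause y C ∧ ∃ u ∈ s, ¬ SatisfiesClause u C)
      ≤ (1 / 2) ^ k * prob (fun v : Fin k → Fin n => ∃ u ∈ s, ∀ r, u (v r) = y (v r)) := by
  classical
  unfold prob
  rw [← expect_not_satisfies_mul y]
  refine expect_le_expect fun C _ => ?_
  by_cases h : ¬ SatisfiesClause y C
  · by_cases h2 : ∃ u ∈ s, ¬ SatisfiesClause u C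
    · obtain ⟨u, hu, h2⟩ := h2
      have h3 : ∃ u ∈ s, ∀ r, u (C r).1 = y (C r).1 := by
        refine ⟨u, hu, fun r => ?_⟩
        have a1 := (not_satisfiesClause_iff _ _).1 h r
        have a2 := (not_satisfiesClause_iff _ _).1 h2 r
        cases e1 : u (C r).1 <;> cases e2 : y (C r).1 <;> simp_all
      rw [if_pos ⟨h, u, hu, h2⟩, if_pos h, if_pos h3]
      norm_num
    · rw [if_neg fun h' => h2 h'.2]
      split_ifs <;> norm_num
  · rw [if_neg fun h' => h h'.1]
    split_ifs <;> norm_num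

variable {K : Type*} [Fintype K] [DecidableEq K]

lemma prob_copy {A : Type*} [Fintype A] [Nonempty A] (a : K) (p : A → Prop) :
    prob (fun c : K → A => p (c a)) = prob p := by
  classical
  unfold prob
  rw [← expect_update a]
  simp

lemma prob_copy_and_copy {A : Type*} [Fintype A] [Nonempty A] {a b : K} (hab : b ≠ a)
    (p q : A → Prop) :
    prob (fun c : K → A => p (c a) ∧ q (c b)) = prob p * prob q := by
  classical
  have h := prob_copy b q
  unfold prob at h ⊢
  rw [← expect_update a, ← h, mul_expect]
  refine expect_congr rfl fun c _ => ?_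
  rw [expect_mul]
  refine expect_congr rfl fun x _ => ?_
  simp only [update_self, update_of_ne hab]
  by_cases h1 : p x <;> by_cases h2 : q (c b) <;> simp [h1, h2]

/-- The probability that some word of the list violates its copy of a random clause. The words
carry the index of the copy they are tested on; distinct copies are independent. -/
def violProb (k : ℕ) (l : List (K × (Fin n → Bool))) : ℝ :=
  prob (fun c : K → Clause k n => ∃ p ∈ l, ¬ SatisfiesClause p.2 (c p.1))

lemma violProb_singleton [NeZero n] (a : K) (y : Fin n → Bool) :
    violProb k [(a, y)] = (1 / 2) ^ k := by
  unfold violProb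
  simp only [List.mem_singleton, exists_eq_left]
  rw [prob_copy a (fun C : Clause k n => ¬ SatisfiesClause y C), prob_not_satisfies]

/-- A new word `y` violates the clause while none of the earlier words does, unless `y` violates it
together with an earlier word; this is unlikely by `hξ` if the latter is tested on the same copy,
and by independence otherwise. -/
lemma violProb_cons_ge [NeZero n] (a : K) (y : Fin n → Bool) (l : List (K × (Fin n → Bool))) {ξ : ℝ}
    (hξ : prob (fun v : Fin k → Fin n => ∃ u ∈ (l.map Prod.snd).toFinset, ∀ r, u (v r) = y (v r))
      ≤ ξ) :
    violProb k l + (1 / 2) ^ k * (1 - ξ - l.length * (1 / 2) ^ k) ≤ violProb k ((a, y) :: l) := by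
  classical
  set E : (K → Clause k n) → Prop := fun c => ¬ SatisfiesClause y (c a) with hE
  set Q : (K → Clause k n) → Prop := fun c => ∃ p ∈ l, ¬ SatisfiesClause p.2 (c p.1) with hQ
  have h1 : violProb k l + prob E ≤ violProb k ((a, y) :: l) + prob (fun c => E c ∧ Q c) := by
    have e : violProb k ((a, y) :: l) = prob (fun c => E c ∨ Q c) :=
      prob_congr fun c => by simp only [List.mem_cons, exists_eq_or_imp, hE, hQ]
    rw [e, prob_or_add_prob_and, add_comm]
    rfl
  have h2 : prob E = (1 / 2) ^ k := by
    rw [hE, prob_copy a (fun C : Clause k n => ¬ SatisfiesClause y C), prob_not_satisfies]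
  have h3 : prob (fun c => E c ∧ Q c)
      ≤ prob (fun c : K → Clause k n => E c ∧
          ∃ u ∈ (l.map Prod.snd).toFinset, ¬ SatisfiesClause u (c a))
        + prob (fun c : K → Clause k n => ∃ p ∈ l.toFinset.filter (fun p => p.1 ≠ a),
          ¬ SatisfiesClause y (c a) ∧ ¬ SatisfiesClause p.2 (c p.1)) := by
    refine le_trans (prob_mono ?_) (prob_or_le _ _)
    rintro c ⟨hc, p, hp, hpc⟩
    by_cases hpa : p.1 = a
    · left
      refine ⟨hc, p.2, ?_, hpa ▸ hpc⟩
      rw [List.mem_toFinset]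
      exact List.mem_map_of_mem hp
    · right
      exact ⟨p, by simp [hp, hpa], hc, hpc⟩
  have h4 : prob (fun c : K → Clause k n => E c ∧
      ∃ u ∈ (l.map Prod.snd).toFinset, ¬ SatisfiesClause u (c a)) ≤ (1 / 2) ^ k * ξ := by
    rw [hE, prob_copy a (fun C : Clause k n => ¬ SatisfiesClause y C ∧
      ∃ u ∈ (l.map Prod.snd).toFinset, ¬ SatisfiesClause u C)]
    exact (prob_not_satisfies_and_le y _).trans (mul_le_mul_of_nonneg_left hξ (by positivity))
  have h5 : prob (fun c : K → Clause k n => ∃ p ∈ l.toFinset.filter (fun p => p.1 ≠ a),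
      ¬ SatisfiesClause y (c a) ∧ ¬ SatisfiesClause p.2 (c p.1))
      ≤ l.length * ((1 / 2) ^ k * (1 / 2) ^ k) := by
    refine (prob_exists_le _ _).trans ?_
    have : ∀ p ∈ l.toFinset.filter (fun p => p.1 ≠ a),
        prob (fun c : K → Clause k n => ¬ SatisfiesClause y (c a) ∧ ¬ SatisfiesClause p.2 (c p.1))
        = (1 / 2) ^ k * (1 / 2) ^ k := by
      intro p hp
      rw [prob_copy_and_copy (mem_filter.1 hp).2 (fun C : Clause k n => ¬ SatisfiesClause y C)
        (fun C => ¬ SatisfiesClause p.2 C), prob_not_satisfies, prob_not_satisfies]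
    rw [sum_congr rfl this, sum_const, nsmul_eq_mul]
    gcongr
    exact (card_filter_le _ _).trans (List.toFinset_card_le _)
  nlinarith

end clause

/-! ### First moment bounds -/

section moment
variable {k n m : ℕ} {K : Type*} [Fintype K] [DecidableEq K]

lemma NuSatisfies.card_le {ν : ℝ} {y : Fin n → Bool} {Φ : Formula k n m}
    (h : NuSatisfies ν y Φ) [DecidablePred fun i => ¬ SatisfiesClause y (Φ i)] :
    ((univ.filter fun i => ¬ SatisfiesClause y (Φ i)).card : ℝ) ≤ ν * m := by
  classical
  unfold NuSatisfies at h
  have h1 : {i : Fin m | SatisfiesClause y (Φ i)}.ncard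
      = (univ.filter fun i => SatisfiesClause y (Φ i)).card := by
    rw [← Set.ncard_coe_finset]
    simp
  have h2 := card_filter_add_card_filter_not (s := (univ : Finset (Fin m)))
    (fun i => SatisfiesClause y (Φ i))
  rw [card_univ, Fintype.card_fin] at h2
  have h3 : ((univ.filter fun i => SatisfiesClause y (Φ i)).card : ℝ)
      + (univ.filter fun i => ¬ SatisfiesClause y (Φ i)).card = m := by exact_mod_cast h2
  rw [h1] at h
  linarith

/-- The probability that all words of a list nearly satisfy their formulas, by Chernoff's bound. The
formula at time `t` takes the copy `κ t i` of its `i`-th clause. -/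
lemma prob_forall_nuSatisfies_le [NeZero n] (κ : ℕ → Fin m → K) (l : List (ℕ × (Fin n → Bool)))
    {ν u s : ℝ} (hs : 0 ≤ s)
    (hu : ∀ i, u ≤ violProb k (l.map fun p => (κ p.1 i, p.2))) :
    prob (fun c : Fin m × K → Clause k n => ∀ p ∈ l, NuSatisfies ν p.2 fun i => c (i, κ p.1 i))
      ≤ Real.exp (s * ν * m * l.length - (1 - Real.exp (-s)) * u * m) := by
  classical
  set G : Fin m → (K → Clause k n) → ℝ := fun i c =>
    if ∃ p ∈ l.map (fun p => (κ p.1 i, p.2)), ¬ SatisfiesClause p.2 (c p.1)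
      then Real.exp (-s) else 1 with hG
  have hG0 : ∀ i c, 0 < G i c := by
    intro i c
    simp only [hG]
    split_ifs <;> positivity
  have hM := prob_le_of_le
    (p := fun c : Fin m × K → Clause k n => ∀ p ∈ l, NuSatisfies ν p.2 fun i => c (i, κ p.1 i))
    (g := fun c => Real.exp (s * ν * m * l.length) * ∏ i, G i (fun a => c (i, a)))
    (fun c => mul_nonneg (Real.exp_pos _).le (prod_nonneg fun i _ =>
      (hG0 i fun a => c (i, a)).le))
    (by
      intro c hc
      set V : Finset (Fin m) := univ.filter fun i => ∃ p ∈ l, ¬ SatisfiesClause p.2 (c (i, κ p.1 i))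
        with hV
      have e1 : ∏ i, G i (fun a => c (i, a)) = Real.exp (-s) ^ V.card := by
        rw [hV, ← prod_const, prod_filter]
        refine prod_congr rfl fun i _ => ?_
        simp only [hG, List.mem_map, exists_exists_and_eq_and]
      have e2 : (V.card : ℝ) ≤ l.length * (ν * m) := by
        have sub : V ⊆ l.toFinset.biUnion fun p =>
            univ.filter fun i => ¬ SatisfiesClause p.2 (c (i, κ p.1 i)) := by
          intro i hi
          obtain ⟨p, hp, hpi⟩ := (mem_filter.1 hi).2
          exact mem_biUnion.2 ⟨p, List.mem_toFinset.2 hp, by simp [hpi]⟩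
        have h1 : (V.card : ℝ) ≤ ∑ p ∈ l.toFinset,
            ((univ.filter fun i => ¬ SatisfiesClause p.2 (c (i, κ p.1 i))).card : ℝ) := by
          exact_mod_cast (card_le_card sub).trans card_biUnion_le
        rcases l.eq_nil_or_concat with h0 | ⟨l', q, h0⟩
        · simp [h0] at h1 ⊢
          exact h1
        · have hq : 0 ≤ ν * m := le_trans (Nat.cast_nonneg _)
            ((hc q (by simp [h0])).card_le)
          refine h1.trans ((sum_le_sum fun p hp => (hc p (List.mem_toFinset.1 hp)).card_le).trans ?_)
          rw [sum_const, nsmul_eq_mul]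
          gcongr
          exact List.toFinset_card_le _
      rw [e1, ← Real.exp_nat_mul, ← Real.exp_add]
      apply Real.one_le_exp
      nlinarith)
  refine hM.trans ?_
  rw [← mul_expect, sub_eq_add_neg, Real.exp_add]
  refine mul_le_mul_of_nonneg_left ?_ (Real.exp_pos _).le
  rw [Fintype.expect_equiv (Equiv.curry (Fin m) K (Clause k n))
    (fun c => ∏ i, G i fun a => c (i, a)) (fun c => ∏ i, G i (c i)) (fun c => rfl), expect_prod_pi]
  have hE : ∀ i, 𝔼 c, G i c ≤ Real.exp (-((1 - Real.exp (-s)) * u)) := by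
    intro i
    refine le_trans ?_ (Real.one_sub_le_exp_neg _)
    have : 𝔼 c, G i c = 1 - (1 - Real.exp (-s)) * violProb k (l.map fun p => (κ p.1 i, p.2)) := by
      unfold violProb prob
      rw [mul_expect, eq_sub_iff_add_eq, ← expect_add_distrib]
      refine Eq.trans (expect_congr rfl fun c _ => ?_) (Fintype.expect_const (1 : ℝ))
      simp only [hG]
      split_ifs <;> ring
    rw [this]
    have h1 : 0 ≤ 1 - Real.exp (-s) := by
      rw [sub_nonneg, Real.exp_le_one_iff]
      linarith
    linarith [mul_le_mul_of_nonneg_left (hu i) h1]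
  refine (prod_le_prod (fun i _ => expect_nonneg fun c _ => (hG0 _ _).le) fun i _ => hE i).trans ?_
  rw [prod_const, card_univ, Fintype.card_fin, ← Real.exp_nat_mul]
  refine le_of_eq ?_
  congr 1
  ring

end moment

/-! ### Chains of words -/

open Classical in
/-- The lists of length `L` over `s`, built from the end, where each entry `a` in front of `l`
satisfies `R l a`. -/
def chains {α : Type*} (s : Finset α) (R : List α → α → Prop) : ℕ → Finset (List α)
  | 0 => {[]}
  | L + 1 => (chains s R L).biUnion fun l => (s.filter (R l)).image (· :: l)

section chains
variable {α : Type*} {s : Finset α} {R : List α → α → Prop}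

lemma mem_chains_succ {L : ℕ} {l' : List α} :
    l' ∈ chains s R (L + 1) ↔ ∃ l ∈ chains s R L, ∃ a ∈ s, R l a ∧ a :: l = l' := by
  simp [chains, and_assoc]

lemma length_of_mem_chains : ∀ {L : ℕ} {l : List α}, l ∈ chains s R L → l.length = L
  | 0, l, h => by
    rw [chains, mem_singleton] at h
    simp [h]
  | L + 1, l, h => by
    obtain ⟨l', h', a, -, -, rfl⟩ := mem_chains_succ.1 h
    simp [length_of_mem_chains h']

open Classical in
lemma card_chains_succ_le {L : ℕ} {B : ℝ}
    (hB : ∀ l ∈ chains s R L, ((s.filter (R l)).card : ℝ) ≤ B) :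
    ((chains s R (L + 1)).card : ℝ) ≤ (chains s R L).card * B := by
  rw [chains]
  have h1 : (((chains s R L).biUnion fun l => (s.filter (R l)).image (· :: l)).card : ℝ)
      ≤ ∑ l ∈ chains s R L, (((s.filter (R l)).image (· :: l)).card : ℝ) := by
    exact_mod_cast card_biUnion_le
  refine h1.trans ?_
  rw [← nsmul_eq_mul]
  refine sum_le_card_nsmul _ _ _ fun l hl => le_trans ?_ (hB l hl)
  exact_mod_cast card_image_le

end chains

/-! ### The resampling path of formulas -/

/-- The path resamples the clauses cyclically, one at a time. At time `t`, the `i`-th clause has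
been resampled `(t + (m - 1 - i)) / m` times; this number indexes the copy of the clause in use. -/
def copyIdx (L m : ℕ) (t : ℕ) (i : Fin m) : Fin (L + 1) :=
  Fin.ofNat (L + 1) ((t + (m - 1 - i)) / m)

/-- The formula at time `t` of the path, as a function of the independent copies of the clauses. -/
def pathFormula {k n m L : ℕ} (c : Fin m × Fin (L + 1) → Clause k n) (t : ℕ) : Formula k n m :=
  fun i => c (i, copyIdx L m t i)

section copyIdx
variable {L m : ℕ}

lemma copyIdx_val {t : ℕ} (ht : t ≤ L * m) (i : Fin m) :
    (copyIdx L m t i : ℕ) = (t + (m - 1 - i)) / m := by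
  have hm : 0 < m := i.pos
  rw [copyIdx, Fin.val_ofNat, Nat.mod_eq_of_lt]
  rw [Nat.div_lt_iff_lt_mul hm]
  have : (L + 1) * m = L * m + m := by ring
  omega

lemma copyIdx_mono {s t : ℕ} (hst : s ≤ t) (ht : t ≤ L * m) (i : Fin m) :
    (copyIdx L m s i : ℕ) ≤ copyIdx L m t i := by
  rw [copyIdx_val (hst.trans ht), copyIdx_val ht]
  exact Nat.div_le_div_right (by omega)

lemma copyIdx_add {t : ℕ} (ht : t + m ≤ L * m) (i : Fin m) :
    (copyIdx L m (t + m) i : ℕ) = copyIdx L m t i + 1 := by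
  have hm : 0 < m := i.pos
  rw [copyIdx_val ht, copyIdx_val (by omega), ← Nat.add_div_right _ hm]
  congr 1
  omega

lemma copyIdx_succ {t : ℕ} (ht : t + 1 ≤ L * m) (i : Fin m) :
    (copyIdx L m (t + 1) i : ℕ) = copyIdx L m t i + if t % m = i then 1 else 0 := by
  have hm : 0 < m := i.pos
  rw [copyIdx_val ht, copyIdx_val (by omega),
    show t + 1 + (m - 1 - i) = (t + (m - 1 - i)) + 1 by omega, Nat.succ_div]
  congr 1
  refine if_congr ?_ rfl rfl
  have hi := i.isLt
  have e : t + (m - 1 - i) + 1 + i = t + m := by omega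
  have h1 : m ∣ t + (m - 1 - i) + 1 ↔ (t + (m - 1 - i) + 1) % m = 0 := Nat.dvd_iff_mod_eq_zero
  rw [h1]
  constructor
  · intro h
    have : (t + m) % m = i := by rw [← e, Nat.add_mod, h, zero_add, Nat.mod_mod, Nat.mod_eq_of_lt hi]
    rwa [Nat.add_mod_right] at this
  · intro h
    have h2 : t = m * (t / m) + i := by rw [← h]; exact (Nat.div_add_mod t m).symm
    have : t + (m - 1 - i) + 1 = m * (t / m + 1) := by
      rw [mul_add, mul_one]; omega
    rw [this, Nat.mul_mod_right]

end copyIdx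

section path
variable {k n m L : ℕ}

lemma prob_pathFormula [NeZero n] (t : ℕ) (p : Formula k n m → Prop) :
    prob (fun c : Fin m × Fin (L + 1) → Clause k n => p (pathFormula c t)) = prob p := by
  classical
  exact expect_comp_injective (e := fun i : Fin m => (i, copyIdx L m t i))
    (fun i j h => (Prod.mk.inj h).1) (fun Φ => if p Φ then (1 : ℝ) else 0)

lemma sum_range_mul_mod [NeZero m] (g : Fin m → ℝ) (L : ℕ) :
    ∑ t ∈ range (L * m), g (Fin.ofNat m t) = L * ∑ i, g i := by
  induction L with
  | zero => simp
  | succ L ih =>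
    rw [add_mul, one_mul, sum_range_add, ih, Nat.cast_succ, add_mul, one_mul,
      ← Fin.sum_univ_eq_sum_range (fun x => g (Fin.ofNat m (L * m + x)))]
    congr 1
    refine sum_congr rfl fun i _ => ?_
    congr 1
    ext
    rw [Fin.val_ofNat, mul_comm, Nat.mul_add_mod, Nat.mod_eq_of_lt i.isLt]

/-- The probability that a degree-`D` polynomial map changes by at most `r` in squared norm at
every step of the path. -/
lemma prob_stable_ge [NeZero n] [NeZero m] {D : ℕ}
    {f : (InputIndex k n m → ℝ) → EuclideanSpace ℝ (Fin n)} (hf : IsDegreePoly D f)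
    {r : ℝ} (hr : 0 < r) :
    Real.exp (-(2 * (k * Real.log (2 * n))
        * (L * (2 * D * 𝔼 Φ : Formula k n m, ‖f (encode Φ)‖ ^ 2 / r))))
      ≤ prob (fun c : Fin m × Fin (L + 1) → Clause k n => ∀ t < L * m,
        ‖f (encode (pathFormula c t)) - f (encode (pathFormula c (t + 1)))‖ ^ 2 ≤ r) := by
  have h := prob_path_ge (e := fun t (i : Fin m) => (i, copyIdx L m t i))
    (fun i j h => (Prod.mk.inj h).1) (i := fun t => Fin.ofNat m t)
    (j := fun t => (Fin.ofNat m t, copyIdx L m (t + 1) (Fin.ofNat m t)))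
    (R := fun Φ Ψ : Formula k n m => ‖f (encode Φ) - f (encode Ψ)‖ ^ 2 ≤ r)
    (fun Φ Ψ h => by rwa [norm_sub_rev]) (fun Φ => by simpa using hr.le) (L * m)
    (fun t ht => by
      ext i : 1
      by_cases hi : i = Fin.ofNat m t
      · subst hi
        rw [update_self]
      · rw [update_of_ne hi, Prod.mk.injEq]
        refine ⟨rfl, Fin.ext ?_⟩
        rw [copyIdx_succ ht, if_neg, add_zero]
        intro h
        exact hi (Fin.ext (by rw [Fin.val_ofNat, h])))
    (fun t ht s hs l h => by
      obtain ⟨rfl, h2⟩ := Prod.mk.inj h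
      have e1 := copyIdx_mono hs (by omega : t ≤ L * m) (Fin.ofNat m t)
      have e2 := copyIdx_succ (L := L) (m := m) (t := t) ht (Fin.ofNat m t)
      rw [if_pos (Fin.val_ofNat _ _).symm] at e2
      have := congrArg Fin.val h2
      omega)
  refine le_trans (Real.exp_le_exp.2 (neg_le_neg ?_)) h
  have hcard : Real.log (Fintype.card (Fin k → Literal n)) = k * Real.log (2 * n) := by
    rw [Fintype.card_fun, Fintype.card_prod, Fintype.card_fin, Fintype.card_fin, Fintype.card_bool]
    push_cast
    rw [Real.log_pow, mul_comm (n : ℝ)]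
  rw [hcard, sum_range_mul_mod (fun i => 𝔼 Φ : Formula k n m,
    prob (fun b => ¬ ‖f (encode Φ) - f (encode (update Φ i b))‖ ^ 2 ≤ r)) L]
  have hn : (1 : ℝ) ≤ n := by exact_mod_cast NeZero.one_le
  have hlog : 0 ≤ Real.log (2 * n) := Real.log_nonneg (by linarith)
  refine mul_le_mul_of_nonneg_left (mul_le_mul_of_nonneg_left ?_ (Nat.cast_nonneg _))
    (by positivity)
  rw [← expect_div, ← mul_div_assoc, le_div_iff₀ hr]
  refine le_trans ?_ (sum_expect_resample_le hf)
  rw [sum_mul]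
  refine sum_le_sum fun i _ => ?_
  rw [expect_mul]
  refine expect_le_expect fun Φ _ => ?_
  rw [← le_div_iff₀ hr, expect_div]
  refine prob_le_of_le (fun C => by positivity) fun C hC => ?_
  rw [le_div_iff₀ hr, one_mul]
  exact (not_le.1 hC).le

end path

/-! ### The forbidden structure -/

section words
variable {n : ℕ}

/-- The label of an index: its values in all the words of the list. -/
def wordLabel (l : List (Fin n → Bool)) (i : Fin n) : List Bool := l.map fun u => u i

/-- The conditional entropy of the word `y` given the words of the list. -/
def wordEnt (l : List (Fin n → Bool)) (y : Fin n → Bool) : ℝ := condEnt (wordLabel l) y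

lemma eq_of_wordLabel_eq {l : List (Fin n → Bool)} {u : Fin n → Bool} (hu : u ∈ l) {i i' : Fin n}
    (h : wordLabel l i = wordLabel l i') : u i = u i' :=
  List.map_inj_left.1 (show l.map (fun u => u i) = l.map (fun u => u i') from h) u hu

lemma wordEnt_of_mem {l : List (Fin n → Bool)} {y : Fin n → Bool} (hy : y ∈ l) :
    wordEnt l y = 0 :=
  condEnt_eq_zero fun _ _ h => eq_of_wordLabel_eq hy h

lemma card_image_wordLabel_le (l : List (Fin n → Bool)) :
    (univ.image (wordLabel l)).card ≤ 2 ^ l.length := by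
  have h : univ.image (wordLabel l)
      ⊆ (univ : Finset (List.Vector Bool l.length)).image fun v => v.toList := by
    intro s hs
    obtain ⟨i, -, rfl⟩ := mem_image.1 hs
    exact mem_image.2 ⟨⟨wordLabel l i, by simp [wordLabel]⟩, mem_univ _, rfl⟩
  refine (card_le_card h).trans (card_image_le.trans ?_)
  rw [card_univ, card_vector, Fintype.card_bool]

open Classical in
lemma card_wordEnt_le [NeZero n] (l : List (Fin n → Bool)) {k : ℕ} (hl : l.length ≤ k) (h : ℝ) :
    ((univ.filter fun y : Fin n → Bool => wordEnt l y ≤ h).card : ℝ)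
      ≤ (n + 1 : ℝ) ^ 2 ^ k * Real.exp (n * h) := by
  have h1 := card_condEnt_le (wordLabel l) h
  rw [Fintype.card_fin] at h1
  have h2 : (univ.image (wordLabel l)).card ≤ 2 ^ k :=
    (card_image_wordLabel_le l).trans (Nat.pow_le_pow_right (by norm_num) hl)
  have h3 : (n + 1 : ℝ) ^ (univ.image (wordLabel l)).card ≤ (n + 1 : ℝ) ^ 2 ^ k :=
    pow_le_pow_right₀ (by linarith [(Nat.cast_nonneg n : (0 : ℝ) ≤ n)]) h2
  refine le_trans ?_ (h1.trans (mul_le_mul_of_nonneg_right h3 (Real.exp_pos _).le))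
  refine le_of_eq ?_
  unfold wordEnt
  congr!

/-- A new word has conditional entropy between `h₀` and `h₁` given the earlier ones. -/
def wordRel (h₀ h₁ : ℝ) : List (ℕ × (Fin n → Bool)) → ℕ × (Fin n → Bool) → Prop
  | [], _ => True
  | q :: l, p => h₀ ≤ wordEnt ((q :: l).map Prod.snd) p.2 ∧
      wordEnt ((q :: l).map Prod.snd) p.2 ≤ h₁

/-- The bound obtained from `prob_exists_agree_le` for the probability that one of at most `k`
earlier words violates a random clause, given that a new word of conditional entropy at least `h`
does. -/
def coViolBound (k : ℕ) (z w h : ℝ) : ℝ :=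
  z * Real.exp (-(k * ((1 - z⁻¹) / w) * (h - 2 * Real.exp (-w)))) + k * Real.exp (-w)
    + k * (1 / 2) ^ k

lemma violProb_chain_ge [NeZero n] {k : ℕ} {K : Type*} [Fintype K] [DecidableEq K] (κ : ℕ → K)
    {s : Finset (ℕ × (Fin n → Bool))} {h₀ h₁ w z : ℝ} (hw : 0 < w) (hz : 1 ≤ z) :
    ∀ {j : ℕ}, j ≤ k → ∀ l ∈ chains s (wordRel h₀ h₁) (j + 1),
      (1 / 2) ^ k * (1 + j * (1 - coViolBound k z w h₀))
        ≤ violProb k (l.map fun p => (κ p.1, p.2))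
  | 0, _, l, hl => by
    obtain ⟨l', hl', a, -, -, rfl⟩ := mem_chains_succ.1 hl
    rw [chains, mem_singleton] at hl'
    subst hl'
    rw [List.map_singleton, violProb_singleton]
    simp
  | j + 1, hj, l, hl => by
    obtain ⟨l', hl', a, -, hR, rfl⟩ := mem_chains_succ.1 hl
    have ih := violProb_chain_ge κ hw hz (by omega : j ≤ k) l' hl'
    have hlen := length_of_mem_chains hl'
    have hR' : h₀ ≤ wordEnt (l'.map Prod.snd) a.2 := by
      cases l' with
      | nil => simp at hlen
      | cons q l'' => exact hR.1
    have hmap : (l'.map fun p => (κ p.1, p.2)).map Prod.snd = l'.map Prod.snd := by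
      rw [List.map_map]
      rfl
    have hA := prob_exists_agree_le (S := wordLabel (l'.map Prod.snd)) a.2 k
      (l'.map Prod.snd).toFinset
      (fun u hu i i' h => eq_of_wordLabel_eq (List.mem_toFinset.1 hu) h) hw hz
    have hV := violProb_cons_ge (k := k) (κ a.1) a.2 (l'.map fun p => (κ p.1, p.2))
      (le_of_eq_of_le (by rw [hmap]) hA)
    rw [List.map_cons]
    refine le_trans ?_ hV
    have hlk : ((l'.map fun p => (κ p.1, p.2)).length : ℝ) ≤ k := by
      rw [List.length_map, hlen]; exact_mod_cast hj
    have hck : ((l'.map Prod.snd).toFinset.card : ℝ) ≤ k := by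
      have := List.toFinset_card_le (l'.map Prod.snd)
      rw [List.length_map, hlen] at this
      exact_mod_cast this.trans hj
    have hzi : 0 ≤ (1 - z⁻¹) / w :=
      div_nonneg (sub_nonneg.2 (inv_le_one_of_one_le₀ hz)) hw.le
    have e1 : Real.exp (-(k * ((1 - z⁻¹) / w) *
          (condEnt (wordLabel (l'.map Prod.snd)) a.2 - 2 * Real.exp (-w))))
        ≤ Real.exp (-(k * ((1 - z⁻¹) / w) * (h₀ - 2 * Real.exp (-w)))) := by
      rw [Real.exp_le_exp, neg_le_neg_iff]
      refine mul_le_mul_of_nonneg_left ?_ (by positivity)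
      exact sub_le_sub_right hR' _
    have e2 : z * Real.exp (-(k * ((1 - z⁻¹) / w) *
          (condEnt (wordLabel (l'.map Prod.snd)) a.2 - 2 * Real.exp (-w))))
        + ((l'.map Prod.snd).toFinset.card : ℝ) * Real.exp (-w)
        + ((l'.map fun p => (κ p.1, p.2)).length : ℝ) * (1 / 2) ^ k ≤ coViolBound k z w h₀ := by
      unfold coViolBound
      gcongr
    have hp : (0 : ℝ) < (1 / 2) ^ k := by positivity
    push_cast
    nlinarith

lemma card_chains_words_le [NeZero n] {k T : ℕ} {h₀ h₁ : ℝ} : ∀ {j : ℕ}, j ≤ k →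
    ((chains (range (T + 1) ×ˢ (univ : Finset (Fin n → Bool))) (wordRel h₀ h₁) (j + 1)).card : ℝ)
      ≤ ((T + 1) * 2 ^ n) * ((T + 1) * ((n + 1 : ℝ) ^ 2 ^ k * Real.exp (n * h₁))) ^ j
  | 0, _ => by
    classical
    refine (card_chains_succ_le (B := (T + 1) * 2 ^ n) fun l _ => ?_).trans ?_
    · refine (Nat.cast_le.2 (card_filter_le _ _)).trans ?_
      rw [card_product, card_range, card_univ, Fintype.card_fun, Fintype.card_fin,
        Fintype.card_bool]
      push_cast
      rfl
    · rw [chains]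
      simp
  | j + 1, hj => by
    classical
    have ih := card_chains_words_le (T := T) (h₀ := h₀) (h₁ := h₁) (by omega : j ≤ k)
    refine (card_chains_succ_le (B := (T + 1) * ((n + 1 : ℝ) ^ 2 ^ k * Real.exp (n * h₁)))
      fun l hl => ?_).trans ?_
    · have hlen := length_of_mem_chains hl
      have hsub : (range (T + 1) ×ˢ (univ : Finset (Fin n → Bool))).filter (wordRel h₀ h₁ l)
          ⊆ range (T + 1) ×ˢ (univ.filter fun y => wordEnt (l.map Prod.snd) y ≤ h₁) := by
        intro p hp
        rw [mem_filter, mem_product] at hp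
        rw [mem_product, mem_filter]
        refine ⟨hp.1.1, mem_univ _, ?_⟩
        cases l with
        | nil => simp at hlen
        | cons q l' => exact hp.2.2
      refine (Nat.cast_le.2 (card_le_card hsub)).trans ?_
      rw [card_product, card_range]
      push_cast
      refine mul_le_mul_of_nonneg_left ?_ (by positivity)
      exact card_wordEnt_le _ (by rw [List.length_map, hlen]; exact hj) _
    · refine (mul_le_mul_of_nonneg_right ih (by positivity)).trans (le_of_eq ?_)
      ring

/-- The overlap gap property: with high probability, the path has no chain of `k + 1` nearly
satisfying words with all conditional entropies between `h₀` and `h₁`. -/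
lemma prob_exists_chain_le [NeZero n] {k m L T : ℕ} {h₀ h₁ w z s ν : ℝ} (hw : 0 < w) (hz : 1 ≤ z)
    (hs : 0 ≤ s) :
    prob (fun c : Fin m × Fin (L + 1) → Clause k n =>
        ∃ l ∈ chains (range (T + 1) ×ˢ (univ : Finset (Fin n → Bool))) (wordRel h₀ h₁) (k + 1),
          ∀ p ∈ l, NuSatisfies ν p.2 (pathFormula c p.1))
      ≤ ((T + 1) * 2 ^ n) * ((T + 1) * ((n + 1 : ℝ) ^ 2 ^ k * Real.exp (n * h₁))) ^ k
        * Real.exp (s * ν * m * (k + 1) - (1 - Real.exp (-s))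
          * ((1 / 2) ^ k * (1 + k * (1 - coViolBound k z w h₀))) * m) := by
  refine (prob_exists_le _ _).trans ?_
  refine (sum_le_card_nsmul _ _ (Real.exp (s * ν * m * (k + 1) - (1 - Real.exp (-s))
          * ((1 / 2) ^ k * (1 + k * (1 - coViolBound k z w h₀))) * m)) fun l hl => ?_).trans ?_
  · have h := prob_forall_nuSatisfies_le (k := k) (ν := ν) (fun t i => copyIdx L m t i) l hs
      (fun i => violProb_chain_ge (fun t => copyIdx L m t i) hw hz le_rfl l hl)
    rw [length_of_mem_chains hl] at h
    push_cast at h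
    exact h
  · rw [nsmul_eq_mul]
    exact mul_le_mul_of_nonneg_right (card_chains_words_le le_rfl) (Real.exp_pos _).le

/-- The times of a list increase. -/
def timeRel (l : List ℕ) (t : ℕ) : Prop := ∀ s ∈ l, s ≤ t

/-- Given the path up to time `t`, the formula at time `t + m` is fresh, so it is unlikely to be
nearly satisfied by a word of small conditional entropy given words that depend on the earlier
formulas. -/
lemma prob_fresh_le [NeZero n] {k m L : ℕ} (Y : Formula k n m → Fin n → Bool) {h s ν : ℝ}
    (hs : 0 ≤ s) {t : ℕ} (ht : t + m ≤ L * m) {τ : List ℕ} (hτ : ∀ r ∈ τ, r ≤ t)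
    (hτk : τ.length ≤ k) :
    prob (fun c : Fin m × Fin (L + 1) → Clause k n => ∃ y,
        wordEnt (τ.map fun r => Y (pathFormula c r)) y ≤ h ∧
          NuSatisfies ν y (pathFormula c (t + m)))
      ≤ (n + 1 : ℝ) ^ 2 ^ k * Real.exp (n * h)
        * Real.exp (s * ν * m - (1 - Real.exp (-s)) * (1 / 2) ^ k * m) := by
  classical
  unfold prob
  rw [← expect_resample (fun q : Fin m × Fin (L + 1) => q.2 = copyIdx L m (t + m) q.1)]
  refine expect_le univ_nonempty fun c _ => ?_
  have e1 : ∀ (c' : Fin m × Fin (L + 1) → Clause k n) (r : ℕ), r ∈ τ →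
      pathFormula (fun q => if q.2 = copyIdx L m (t + m) q.1 then c' q else c q) r
        = pathFormula c r := by
    intro c' r hr
    ext1 i
    unfold pathFormula
    refine if_neg fun h => ?_
    have a1 := copyIdx_mono (hτ r hr) (by omega : t ≤ L * m) i
    have a2 := copyIdx_add ht i
    have a3 := congrArg Fin.val h
    simp only at a3
    omega
  have e2 : ∀ c' : Fin m × Fin (L + 1) → Clause k n,
      pathFormula (fun q => if q.2 = copyIdx L m (t + m) q.1 then c' q else c q) (t + m)
        = pathFormula c' (t + m) := by
    intro c'
    ext1 i
    exact if_pos rfl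
  have e3 : ∀ c' : Fin m × Fin (L + 1) → Clause k n, (τ.map fun r => Y (pathFormula
      (fun q => if q.2 = copyIdx L m (t + m) q.1 then c' q else c q) r))
      = τ.map fun r => Y (pathFormula c r) := by
    intro c'
    exact List.map_congr_left fun r hr => by rw [e1 c' r hr]
  simp only [e2, e3]
  set l := τ.map fun r => Y (pathFormula c r) with hl
  have key : prob (fun c' : Fin m × Fin (L + 1) → Clause k n =>
      ∃ y ∈ univ.filter (fun y : Fin n → Bool => wordEnt l y ≤ h),
        NuSatisfies ν y (pathFormula c' (t + m)))
      ≤ (n + 1 : ℝ) ^ 2 ^ k * Real.exp (n * h)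
        * Real.exp (s * ν * m - (1 - Real.exp (-s)) * (1 / 2) ^ k * m) := by
    refine (prob_exists_le _ _).trans ?_
    refine (sum_le_card_nsmul _ _
      (Real.exp (s * ν * m - (1 - Real.exp (-s)) * (1 / 2) ^ k * m)) fun y _ => ?_).trans ?_
    · have h1 := prob_forall_nuSatisfies_le (k := k) (ν := ν) (u := (1 / 2) ^ k)
        (fun t i => copyIdx L m t i) [(t + m, y)] hs
        (fun i => by rw [List.map_singleton, violProb_singleton])
      simp only [List.mem_singleton, forall_eq, List.length_singleton, Nat.cast_one, mul_one] at h1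
      exact h1
    · rw [nsmul_eq_mul]
      refine mul_le_mul_of_nonneg_right ?_ (Real.exp_pos _).le
      exact card_wordEnt_le _ (by rw [hl, List.length_map]; exact hτk) _
  refine le_trans (le_of_eq ?_) key
  unfold prob
  refine expect_congr rfl fun c' _ => ?_
  simp only [mem_filter, mem_univ, true_and]

end words

/-! ### Following the path into the forbidden structure -/

lemma card_chains_le_pow {α : Type*} (s : Finset α) (R : List α → α → Prop) :
    ∀ j : ℕ, ((chains s R j).card : ℝ) ≤ (s.card : ℝ) ^ j
  | 0 => by simp [chains]
  | j + 1 => by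
    classical
    refine (card_chains_succ_le (B := s.card) fun l _ => ?_).trans ?_
    · exact_mod_cast card_filter_le _ _
    · rw [pow_succ]
      exact mul_le_mul_of_nonneg_right (card_chains_le_pow s R j) (Nat.cast_nonneg _)

/-- A sequence of words whose conditional entropies move in small steps, but are large after every
`m` steps, contains a chain with conditional entropies in `[h₀, h₁]`: the next word of the chain is
the first one with conditional entropy at least `h₀`. -/
lemma exists_chain {n m L T : ℕ} (hT : T = L * m) {h₀ h₁ : ℝ} (h0 : 0 < h₀) (y : ℕ → Fin n → Bool)
    (hjump : ∀ t < T, ∀ l, wordEnt l (y (t + 1)) ≤ wordEnt l (y t) + (h₁ - h₀))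
    (hfresh : ∀ j < L, ∀ τ ∈ chains (range (T + 1)) timeRel (j + 1), ∀ t, (∀ r ∈ τ, r ≤ t) →
      t + m ≤ T → h₀ < wordEnt (τ.map y) (y (t + m))) :
    ∀ j ≤ L, ∃ (t : ℕ) (l : List (ℕ × (Fin n → Bool))), t ≤ j * m ∧
      (t, y t) :: l ∈ chains (range (T + 1) ×ˢ (univ : Finset (Fin n → Bool)))
        (wordRel h₀ h₁) (j + 1) ∧
      t :: l.map Prod.fst ∈ chains (range (T + 1)) timeRel (j + 1) ∧
      ∀ p ∈ (t, y t) :: l, p.1 ≤ t ∧ p.2 = y p.1 := by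
  intro j
  induction j with
  | zero =>
    intro _
    refine ⟨0, [], Nat.zero_le _, mem_chains_succ.2 ⟨[], ?_, (0, y 0), ?_, trivial, rfl⟩,
      mem_chains_succ.2 ⟨[], ?_, 0, ?_, ?_, rfl⟩, ?_⟩ <;> simp [chains, timeRel]
  | succ j ih =>
    intro hj
    obtain ⟨t, l, htj, hl, hτ, hp⟩ := ih (by omega)
    have hjm : (j + 1) * m ≤ T := by
      rw [hT]; exact Nat.mul_le_mul_right _ hj
    have htm : t + m ≤ (j + 1) * m := by rw [add_mul, one_mul]; omega
    have hmap : ((t, y t) :: l).map Prod.snd = (t :: l.map Prod.fst).map y := by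
      rw [show t :: l.map Prod.fst = ((t, y t) :: l).map Prod.fst from rfl, List.map_map]
      exact List.map_congr_left fun p hpl => (hp p hpl).2
    set lw := ((t, y t) :: l).map Prod.snd with hlw
    have hbig : h₀ < wordEnt lw (y (t + m)) := by
      rw [hmap]
      refine hfresh j hj _ hτ t (fun r hr => ?_) (by omega)
      rw [show t :: l.map Prod.fst = ((t, y t) :: l).map Prod.fst from rfl] at hr
      obtain ⟨p, hpl, rfl⟩ := List.mem_map.1 hr
      exact (hp p hpl).1
    have hex : ∃ d, h₀ ≤ wordEnt lw (y (t + d)) := ⟨m, hbig.le⟩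
    classical
    obtain ⟨d, hd, hdmin⟩ : ∃ d, h₀ ≤ wordEnt lw (y (t + d)) ∧
        ∀ d' < d, wordEnt lw (y (t + d')) < h₀ :=
      ⟨Nat.find hex, Nat.find_spec hex, fun d' hd' => not_le.1 (Nat.find_min hex hd')⟩
    have hdm : d ≤ m := by
      by_contra hc
      exact absurd hbig (not_lt.2 (hdmin m (by omega)).le)
    have hzero : wordEnt lw (y t) = 0 := wordEnt_of_mem (by simp [hlw])
    have hd0 : d ≠ 0 := by
      rintro rfl
      rw [add_zero, hzero] at hd
      linarith
    obtain ⟨d, rfl⟩ := Nat.exists_eq_succ_of_ne_zero hd0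
    have hupper : wordEnt lw (y (t + (d + 1))) ≤ h₁ := by
      have a1 := hjump (t + d) (by omega) lw
      have a2 := hdmin d (Nat.lt_succ_self d)
      rw [← add_assoc]
      linarith
    refine ⟨t + (d + 1), (t, y t) :: l, by omega, mem_chains_succ.2 ⟨_, hl, _, ?_, ?_, rfl⟩,
      mem_chains_succ.2 ⟨_, hτ, _, ?_, ?_, rfl⟩, ?_⟩
    · simp only [mem_product, mem_range, mem_univ, and_true]
      omega
    · exact ⟨hd, hupper⟩
    · rw [mem_range]
      omega
    · intro r hr
      rw [show t :: l.map Prod.fst = ((t, y t) :: l).map Prod.fst from rfl] at hr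
      obtain ⟨p, hpl, rfl⟩ := List.mem_map.1 hr
      have := (hp p hpl).1
      omega
    · intro p hpl
      rcases List.mem_cons.1 hpl with rfl | hpl
      · exact ⟨le_rfl, rfl⟩
      · exact ⟨(hp p hpl).1.trans (by omega), (hp p hpl).2⟩

/-- Words close to the rounded values of two close vectors are close to each other: rounding to
different signs takes a change of at least `2` in the coordinate. -/
lemma card_ne_le_of_round {n : ℕ} (hn : 0 < n) {a b : EuclideanSpace ℝ (Fin n)} {y z : Fin n → Bool}
    {η r : ℝ} (ha : normHamming (fun i => roundOutput (a i)) (fun i => some (y i)) ≤ η)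
    (hb : normHamming (fun i => roundOutput (b i)) (fun i => some (z i)) ≤ η)
    (hab : ‖a - b‖ ^ 2 ≤ r * n) :
    ((univ.filter fun i => z i ≠ y i).card : ℝ) ≤ (2 * η + r / 4) * n := by
  have hn' : (0 : ℝ) < n := by exact_mod_cast hn
  unfold normHamming hammingDist at ha hb
  rw [div_le_iff₀ hn'] at ha hb
  set A := univ.filter fun i => roundOutput (a i) ≠ some (y i)
  set B := univ.filter fun i => roundOutput (b i) ≠ some (z i)
  set F := univ.filter fun i => 4 ≤ (a i - b i) ^ 2 with hF
  have hsub : (univ.filter fun i => z i ≠ y i) ⊆ A ∪ B ∪ F := by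
    intro i hi
    have hzy := (mem_filter.1 hi).2
    by_contra hc
    simp only [A, B, F, mem_union, mem_filter, mem_univ, true_and, not_or, not_not, not_le] at hc
    obtain ⟨⟨h1, h2⟩, h3⟩ := hc
    unfold roundOutput at h1 h2
    split_ifs at h1 h2 <;> simp_all <;> nlinarith
  have hFc : 4 * (F.card : ℝ) ≤ r * n := by
    refine le_trans ?_ hab
    rw [EuclideanSpace.norm_sq_eq]
    have : 4 * (F.card : ℝ) = ∑ i ∈ F, 4 := by rw [sum_const, nsmul_eq_mul, mul_comm]
    rw [this]
    refine (sum_le_sum fun i hi => (mem_filter.1 hi).2).trans ?_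
    refine (sum_le_sum_of_subset_of_nonneg (subset_univ F) fun _ _ _ => sq_nonneg _).trans ?_
    exact sum_le_sum fun i _ => by rw [Real.norm_eq_abs, sq_abs, PiLp.sub_apply]
  have hcard : ((univ.filter fun i => z i ≠ y i).card : ℝ) ≤ A.card + B.card + F.card := by
    have h1 := card_le_card hsub
    have h2 := card_union_le (A ∪ B) F
    have h3 := card_union_le A B
    exact_mod_cast h1.trans (h2.trans (by omega))
  linarith

/-- The comparison of probabilities behind the theorem. A stable path along which a polynomial
succeeds either meets the forbidden structure, or has a formula nearly satisfied by a word close to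
words that depend on an independent part of the path. -/
theorem exp_neg_stability_le {k n m D : ℕ} [NeZero n] [NeZero m]
    {f : (InputIndex k n m → ℝ) → EuclideanSpace ℝ (Fin n)} (hf : IsDegreePoly D f)
    {η ν r ε h₀ h₁ w z s : ℝ} (hr : 0 < r) (hε : 0 < ε) (hε1 : ε < 1) (hηε : 2 * η + r / 4 ≤ ε)
    (h0 : 0 < h₀) (hgap : -Real.log (1 - ε) - ε * Real.log ε ≤ h₁ - h₀)
    (hw : 0 < w) (hz : 1 ≤ z) (hs : 0 ≤ s) :
    Real.exp (-(2 * (k * Real.log (2 * n))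
        * (k * (2 * D * 𝔼 Φ : Formula k n m, ‖f (encode Φ)‖ ^ 2 / (r * n)))))
      ≤ (k * m + 1) * prob (fun Φ : Formula k n m =>
          ¬ EtaNuSatisfies η ν (fun i => roundOutput (f (encode Φ) i)) Φ)
        + ((k * m + 1) * 2 ^ n) * ((k * m + 1) * ((n + 1 : ℝ) ^ 2 ^ k * Real.exp (n * h₁))) ^ k
          * Real.exp (s * ν * m * (k + 1) - (1 - Real.exp (-s))
            * ((1 / 2) ^ k * (1 + k * (1 - coViolBound k z w h₀))) * m)
        + k * ((k * m + 1) ^ k * ((k * m + 1) * ((n + 1 : ℝ) ^ 2 ^ k * Real.exp (n * h₀)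
          * Real.exp (s * ν * m - (1 - Real.exp (-s)) * (1 / 2) ^ k * m)))) := by
  classical
  set ok : Formula k n m → Prop :=
    fun Φ => EtaNuSatisfies η ν (fun i => roundOutput (f (encode Φ) i)) Φ with hok
  obtain ⟨Y, hY⟩ : ∃ Y : Formula k n m → Fin n → Bool, ∀ Φ, ok Φ →
      normHamming (fun i => roundOutput (f (encode Φ) i)) (fun i => some (Y Φ i)) ≤ η ∧
        NuSatisfies ν (Y Φ) Φ := by
    have : ∀ Φ, ∃ y : Fin n → Bool, ok Φ →
        normHamming (fun i => roundOutput (f (encode Φ) i)) (fun i => some (y i)) ≤ η ∧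
          NuSatisfies ν y Φ := by
      intro Φ
      by_cases h : ok Φ
      · obtain ⟨y, hy⟩ := h
        exact ⟨y, fun _ => hy⟩
      · exact ⟨fun _ => true, fun h' => absurd h' h⟩
    choose Y hY using this
    exact ⟨Y, hY⟩
  have hn : 0 < n := Nat.pos_of_ne_zero (NeZero.ne n)
  have hn' : (0 : ℝ) < n := by exact_mod_cast hn
  set T := k * m with hT
  set E1 : (Fin m × Fin (k + 1) → Clause k n) → Prop :=
    fun c => ∃ t ∈ range (T + 1), ¬ ok (pathFormula c t) with hE1
  set E2 : (Fin m × Fin (k + 1) → Clause k n) → Prop := fun c =>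
    ∃ l ∈ chains (range (T + 1) ×ˢ (univ : Finset (Fin n → Bool))) (wordRel h₀ h₁) (k + 1),
      ∀ p ∈ l, NuSatisfies ν p.2 (pathFormula c p.1) with hE2
  set E3 : (Fin m × Fin (k + 1) → Clause k n) → Prop := fun c =>
    ∃ j ∈ range k, ∃ τ ∈ chains (range (T + 1)) timeRel (j + 1), ∃ t ∈ range (T + 1),
      ((∀ r ∈ τ, r ≤ t) ∧ t + m ≤ T) ∧ ∃ y, wordEnt (τ.map fun r => Y (pathFormula c r)) y ≤ h₀ ∧
        NuSatisfies ν y (pathFormula c (t + m)) with hE3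
  have key : ∀ c : Fin m × Fin (k + 1) → Clause k n,
      (∀ t < T, ‖f (encode (pathFormula c t)) - f (encode (pathFormula c (t + 1)))‖ ^ 2 ≤ r * n) →
      (E1 c ∨ E2 c) ∨ E3 c := by
    intro c hc
    by_contra hcon
    rw [not_or, not_or] at hcon
    obtain ⟨⟨n1, n2⟩, n3⟩ := hcon
    have hokt : ∀ t ≤ T, ok (pathFormula c t) := by
      intro t ht
      by_contra h
      exact n1 ⟨t, mem_range.2 (by omega), h⟩
    obtain ⟨t, l, ht, hl, -, hp⟩ := exists_chain hT h0 (fun t => Y (pathFormula c t))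
      (h₁ := h₁) (fun t ht l => by
        have hd := card_ne_le_of_round hn (hY _ (hokt t ht.le)).1 (hY _ (hokt (t + 1) ht)).1
          (hc t ht)
        have hd' : ((univ.filter fun i => Y (pathFormula c (t + 1)) i ≠ Y (pathFormula c t) i).card
            : ℝ) ≤ ε * Fintype.card (Fin n) := by
          rw [Fintype.card_fin]
          exact hd.trans (mul_le_mul_of_nonneg_right hηε hn'.le)
        have := condEnt_le_add (wordLabel l) hε hε1 hd'
        exact this.trans (add_le_add le_rfl hgap))
      (fun j hj τ hτ t hτt htm => by
        by_contra hcon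
        exact n3 ⟨j, mem_range.2 hj, τ, hτ, t, mem_range.2 (by omega), ⟨hτt, htm⟩, _,
          not_lt.1 hcon, (hY _ (hokt _ htm)).2⟩) k le_rfl
    refine n2 ⟨_, hl, fun p hpl => ?_⟩
    obtain ⟨a1, a2⟩ := hp p hpl
    rw [a2]
    exact (hY _ (hokt _ (a1.trans ht))).2
  have hcast : ((T : ℕ) : ℝ) = k * m := by rw [hT]; push_cast; ring
  have b1 : prob E1 ≤ (k * m + 1) * prob (fun Φ => ¬ ok Φ) := by
    refine (prob_exists_le _ _).trans ?_
    rw [sum_congr rfl fun t _ => prob_pathFormula t (fun Φ => ¬ ok Φ), sum_const, card_range,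
      nsmul_eq_mul]
    push_cast
    rw [hcast]
  have b2 := prob_exists_chain_le (k := k) (m := m) (n := n) (L := k) (T := T) (h₀ := h₀)
    (h₁ := h₁) (ν := ν) hw hz hs
  have b3 : prob E3 ≤ k * ((k * m + 1) ^ k * ((k * m + 1) * ((n + 1 : ℝ) ^ 2 ^ k
      * Real.exp (n * h₀) * Real.exp (s * ν * m - (1 - Real.exp (-s)) * (1 / 2) ^ k * m)))) := by
    have hT0 : (0 : ℝ) ≤ k * m := by positivity
    set Q := (n + 1 : ℝ) ^ 2 ^ k * Real.exp (n * h₀)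
      * Real.exp (s * ν * m - (1 - Real.exp (-s)) * (1 / 2) ^ k * m) with hQ
    have hQ0 : 0 ≤ Q := by positivity
    refine (prob_exists_le _ _).trans ?_
    refine (sum_le_card_nsmul _ _ ((k * m + 1) ^ k * ((k * m + 1) * Q)) fun j hj => ?_).trans ?_
    · rw [mem_range] at hj
      refine (prob_exists_le _ _).trans ?_
      refine (sum_le_card_nsmul _ _ ((k * m + 1) * Q) fun τ hτ => ?_).trans ?_
      · refine (prob_exists_le _ _).trans ?_
        refine (sum_le_card_nsmul _ _ Q fun t _ => ?_).trans ?_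
        · by_cases hcond : (∀ r ∈ τ, r ≤ t) ∧ t + m ≤ T
          · refine (prob_mono fun c hc => hc.2).trans ?_
            refine prob_fresh_le Y hs hcond.2 hcond.1 ?_
            rw [length_of_mem_chains hτ]
            exact hj
          · refine le_trans (le_of_eq ?_) hQ0
            exact expect_eq_zero fun c _ => if_neg fun h => hcond h.1
        · rw [card_range, nsmul_eq_mul]
          push_cast
          rw [hcast]
      · rw [nsmul_eq_mul]
        refine mul_le_mul_of_nonneg_right ?_ (by positivity)
        refine (card_chains_le_pow _ _ _).trans ?_
        rw [card_range]
        push_cast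
        rw [hcast]
        exact pow_le_pow_right₀ (by linarith) (by omega)
    · rw [card_range, nsmul_eq_mul]
  refine (prob_stable_ge (L := k) hf (mul_pos hr hn')).trans ?_
  refine (prob_mono key).trans ((prob_or_le _ _).trans ?_)
  refine add_le_add ((prob_or_le _ _).trans (add_le_add b1 ?_)) b3
  rw [hcast] at b2
  exact b2

/-! ### Fixing the internal randomness -/

instance isProbabilityMeasure_randomKSAT (k n m : ℕ) [NeZero n] :
    IsProbabilityMeasure (randomKSAT k n m) :=
  ProbabilityTheory.isProbabilityMeasure_uniformOn Set.finite_univ Set.univ_nonempty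

lemma integral_randomKSAT {k n m : ℕ} [NeZero n] (g : Formula k n m → ℝ) :
    ∫ Φ, g Φ ∂(randomKSAT k n m) = 𝔼 Φ, g Φ := by
  rw [integral_fintype .of_finite, Fintype.expect_eq_sum_div_card, sum_div]
  refine sum_congr rfl fun Φ _ => ?_
  rw [measureReal_def, randomKSAT, ProbabilityTheory.uniformOn_univ, Measure.count_singleton,
    smul_eq_mul, ENNReal.toReal_div]
  simp only [ENNReal.toReal_one, ENNReal.toReal_natCast]
  ring

/-- If a random polynomial solves random `k`-SAT, then some realization of it has comparable failure
probability and second moment. -/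
lemma exists_deterministic {k n m D : ℕ} [NeZero n] {Ω : Type*} [MeasurableSpace Ω] {P : Measure Ω}
    [IsProbabilityMeasure P] {f : (InputIndex k n m → ℝ) → Ω → EuclideanSpace ℝ (Fin n)}
    (hf : IsRandomDegreePoly D f) {δ γ η ν δ' : ℝ} (hs : Solves P f δ γ η ν) (hδ : δ ≤ δ')
    (hδ' : 0 < δ') (hγ : 0 < γ) :
    ∃ g : (InputIndex k n m → ℝ) → EuclideanSpace ℝ (Fin n), IsDegreePoly D g ∧
      prob (fun Φ : Formula k n m =>
        ¬ EtaNuSatisfies η ν (fun i => roundOutput (g (encode Φ) i)) Φ) ≤ 2 * δ' ∧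
      𝔼 Φ : Formula k n m, ‖g (encode Φ)‖ ^ 2 ≤ 2 * γ * n := by
  classical
  have hn : (0 : ℝ) < n := by exact_mod_cast Nat.pos_of_ne_zero (NeZero.ne n)
  set μ := randomKSAT k n m
  set A : Set (Formula k n m × Ω) :=
    {q | EtaNuSatisfies η ν (fun i => roundOutput (f (encode q.1) q.2 i)) q.1} with hA
  have hAm : MeasurableSet A := by
    let _ : MeasurableSpace (Option Bool) := ⊤
    have : DiscreteMeasurableSpace (Option Bool) := ⟨fun _ => trivial⟩
    have hround : Measurable roundOutput := by
      unfold roundOutput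
      exact Measurable.ite measurableSet_Ici measurable_const
        (Measurable.ite measurableSet_Iic measurable_const measurable_const)
    have hW : Measurable fun q : Formula k n m × Ω =>
        (q.1, fun i => roundOutput (f (encode q.1) q.2 i)) := by
      refine measurable_fst.prodMk (measurable_from_prod_countable_right fun Φ => ?_)
      refine measurable_pi_lambda _ fun i => hround.comp ?_
      exact (EuclideanSpace.proj (𝕜 := ℝ) i).continuous.measurable.comp (hf.measurable (encode Φ))
    exact hW (t := {p : Formula k n m × (Fin n → Option Bool) | EtaNuSatisfies η ν p.2 p.1})
      (Set.to_countable _).measurableSet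
  set F : Formula k n m × Ω → ℝ := fun q =>
    Aᶜ.indicator (fun _ => (1 : ℝ)) q / δ' + ‖f (encode q.1) q.2‖ ^ 2 / (γ * n) with hF
  have hi1 : Integrable (fun q => Aᶜ.indicator (fun _ => (1 : ℝ)) q) (μ.prod P) :=
    (integrable_const 1).indicator hAm.compl
  have hFi : Integrable F (μ.prod P) := (hi1.div_const _).add (hs.integrable.div_const _)
  have hint : ∫ q, F q ∂(μ.prod P) ≤ 2 := by
    rw [hF, integral_add (hi1.div_const _) (hs.integrable.div_const _), integral_div, integral_div,
      integral_indicator_const _ hAm.compl, probReal_compl_eq_one_sub hAm, smul_eq_mul, mul_one]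
    have h1 : (1 - (μ.prod P).real A) / δ' ≤ 1 := by
      rw [div_le_one hδ']
      linarith [hs.success]
    have h2 : (∫ q : Formula k n m × Ω, ‖f (encode q.1) q.2‖ ^ 2 ∂(μ.prod P)) / (γ * n) ≤ 1 := by
      rw [div_le_one (by positivity)]
      exact hs.normalization
    linarith
  rw [integral_prod_symm F hFi] at hint
  obtain ⟨ω, hω⟩ := exists_le_integral (hFi.integral_prod_right)
  have h3 := hω.trans hint
  rw [integral_randomKSAT] at h3
  simp only [hF] at h3
  rw [expect_add_distrib, ← expect_div, ← expect_div] at h3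
  have h4 : 𝔼 Φ : Formula k n m, Aᶜ.indicator (fun _ => (1 : ℝ)) (Φ, ω)
      = prob (fun Φ : Formula k n m =>
        ¬ EtaNuSatisfies η ν (fun i => roundOutput (f (encode Φ) ω i)) Φ) := by
    unfold prob
    refine expect_congr rfl fun Φ _ => ?_
    rw [Set.indicator_apply]
    congr
  rw [h4] at h3
  have p1 := prob_nonneg (fun Φ : Formula k n m =>
        ¬ EtaNuSatisfies η ν (fun i => roundOutput (f (encode Φ) ω i)) Φ)
  have p2 : 0 ≤ 𝔼 Φ : Formula k n m, ‖f (encode Φ) ω‖ ^ 2 :=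
    expect_nonneg fun _ _ => sq_nonneg _
  have p3 : 0 < γ * n := by positivity
  refine ⟨fun x => f x ω, hf.poly ω, ?_, ?_⟩
  · have := div_nonneg p2 p3.le
    rw [← div_le_iff₀ hδ']
    linarith
  · have := div_nonneg p1 hδ'.le
    rw [mul_assoc, ← div_le_iff₀ p3]
    linarith

open Filter Topology

/-! ### Asymptotics -/

/-- Any polynomial factor is eventually beaten by `exp (a n)`. -/
lemma eventually_pow_le_exp {C M a : ℝ} (hC : 0 ≤ C) (ha : 0 < a) (p : ℕ) :
    ∀ᶠ n : ℕ in atTop, M * (C * n + 1) ^ p ≤ Real.exp (a * n) := by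
  have h1 : Tendsto (fun x : ℝ => |M| * (C + 1) ^ p * (x ^ p * Real.exp (-a * x))) atTop
      (𝓝 (|M| * (C + 1) ^ p * 0)) := by
    refine Tendsto.const_mul _ ?_
    have := (isLittleO_pow_exp_pos_mul_atTop p ha).tendsto_div_nhds_zero
    refine this.congr fun x => ?_
    rw [neg_mul, Real.exp_neg, div_eq_mul_inv]
  rw [mul_zero] at h1
  have h2 := (h1.comp tendsto_natCast_atTop_atTop).eventually (ge_mem_nhds one_pos)
  filter_upwards [h2, eventually_ge_atTop 1] with n hn hn1
  have hn1' : (1 : ℝ) ≤ n := by exact_mod_cast hn1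
  simp only [comp_apply, neg_mul, Real.exp_neg] at hn
  have h3 : M * (C * n + 1) ^ p ≤ |M| * (C + 1) ^ p * (n : ℝ) ^ p := by
    rw [mul_assoc, ← mul_pow]
    refine mul_le_mul (le_abs_self M) ?_ (by positivity) (abs_nonneg _)
    refine pow_le_pow_left₀ (by positivity) ?_ p
    linarith
  refine h3.trans ?_
  rw [← mul_assoc, ← div_eq_mul_inv, div_le_one (Real.exp_pos _)] at hn
  exact hn

/-- The exponential rate of the first moment of the chains of words. -/
def chainRate (κ : ℝ) (k : ℕ) (β ρ ξ : ℝ) : ℝ :=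
  Real.log 2 + (β + ρ) * Real.log k + κ * Real.log k ^ 2 * (k + 1) / (k : ℝ) ^ 3
    - (1 - 1 / k) * κ * (1 - ξ) * Real.log k

/-- The exponential rate of the first moment of a single word of small conditional entropy. -/
def freshRate (κ : ℝ) (k : ℕ) (β : ℝ) : ℝ :=
  (β + κ * Real.log k / (k : ℝ) ^ 2 - (1 - 1 / k) * κ) * (Real.log k / k)

/-- The truncation level for the information density: `log k` to leading order, but large enough for
the union bound over `k` words, as `k * exp (-truncLevel k) = 1 / log k` tends to `0`. -/
def truncLevel (k : ℕ) : ℝ := Real.log k + Real.log (Real.log k)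

lemma tendsto_log_natCast : Tendsto (fun k : ℕ => Real.log k) atTop atTop :=
  Real.tendsto_log_atTop.comp tendsto_natCast_atTop_atTop

lemma tendsto_log_div_natCast : Tendsto (fun k : ℕ => Real.log k / (k : ℝ)) atTop (𝓝 0) :=
  (Real.isLittleO_log_id_atTop.tendsto_div_nhds_zero).comp tendsto_natCast_atTop_atTop

lemma exp_neg_truncLevel {k : ℕ} (hk : 0 < Real.log k) :
    Real.exp (-truncLevel k) = 1 / (k * Real.log k) := by
  have hk0 : (0 : ℝ) < k := by
    rcases Nat.eq_zero_or_pos k with rfl | h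
    · simp at hk
    · exact_mod_cast h
  rw [truncLevel, ← Real.log_mul hk0.ne' hk.ne', Real.exp_neg, Real.exp_log (by positivity),
    one_div]

/-- As `k → ∞`, the bound for the probability of a common violation converges to `β e^{-(β-1)}`. -/
lemma tendsto_coViolBound {β : ℝ} (hβ : 1 < β) :
    Tendsto (fun k : ℕ => coViolBound k β (truncLevel k) (β * Real.log k / k)) atTop
      (𝓝 (β * Real.exp (-(β - 1)))) := by
  have hlog := tendsto_log_natCast
  have hloginv : Tendsto (fun k : ℕ => 1 / Real.log k) atTop (𝓝 0) := by
    exact hlog.inv_tendsto_atTop.congr fun k => (one_div _).symm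
  have hloglog : Tendsto (fun k : ℕ => Real.log (Real.log k) / Real.log k) atTop (𝓝 0) :=
    (Real.isLittleO_log_id_atTop.tendsto_div_nhds_zero).comp hlog
  have hratio : Tendsto (fun k : ℕ => (1 - β⁻¹) * ((β - 2 * (1 / Real.log k) * (1 / Real.log k)) /
      (1 + Real.log (Real.log k) / Real.log k))) atTop
      (𝓝 ((1 - β⁻¹) * ((β - 2 * 0 * 0) / (1 + 0)))) :=
    ((tendsto_const_nhds.sub ((hloginv.const_mul 2).mul hloginv)).div
      (tendsto_const_nhds.add hloglog) (by norm_num)).const_mul _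
  have hlim : (1 - β⁻¹) * ((β - 2 * 0 * 0) / (1 + 0)) = β - 1 := by
    have : β ≠ 0 := by linarith
    field_simp
    ring
  rw [hlim] at hratio
  have hgeo : Tendsto (fun k : ℕ => (k : ℝ) * (1 / 2) ^ k) atTop (𝓝 0) := by
    simpa using tendsto_self_mul_const_pow_of_lt_one (r := (1 / 2 : ℝ)) (by norm_num) (by norm_num)
  have hmain : Tendsto (fun k : ℕ => β * Real.exp (-((1 - β⁻¹) * ((β - 2 * (1 / Real.log k)
      * (1 / Real.log k)) / (1 + Real.log (Real.log k) / Real.log k)))) + 1 / Real.log k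
      + (k : ℝ) * (1 / 2) ^ k) atTop (𝓝 (β * Real.exp (-(β - 1)) + 0 + 0)) :=
    ((((Real.continuous_exp.tendsto _).comp hratio.neg).const_mul β).add hloginv).add hgeo
  rw [add_zero, add_zero] at hmain
  refine hmain.congr' ?_
  filter_upwards [hlog.eventually_gt_atTop 1, eventually_ge_atTop 1] with k hk hk1
  have hl : 0 < Real.log k := by linarith
  have hk0 : (0 : ℝ) < k := by exact_mod_cast hk1
  have hll : 0 < Real.log (Real.log k) := Real.log_pos hk
  have hw : 0 < truncLevel k := add_pos hl hll
  unfold coViolBound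
  rw [exp_neg_truncLevel hl]
  congr 2
  · congr 3
    have : truncLevel k = Real.log k * (1 + Real.log (Real.log k) / Real.log k) := by
      unfold truncLevel
      field_simp
    rw [this]
    have h1 : 0 < 1 + Real.log (Real.log k) / Real.log k := by positivity
    field_simp
  · field_simp

lemma eventually_chainRate_neg {κ β ρ x : ℝ} {ξ : ℕ → ℝ} (hξ : Tendsto ξ atTop (𝓝 x))
    (hκ : β + ρ < κ * (1 - x)) : ∀ᶠ k : ℕ in atTop, chainRate κ k β ρ (ξ k) < 0 := by
  have hlog := tendsto_log_natCast
  have hinv : Tendsto (fun k : ℕ => 1 / (k : ℝ)) atTop (𝓝 0) := tendsto_one_div_atTop_nhds_zero_nat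
  have h1 : Tendsto (fun k : ℕ => Real.log 2 * (Real.log k)⁻¹ + (β + ρ)
      + κ * (Real.log k / k) * (1 / k + 1 / k * (1 / k)) - (1 - 1 / k) * κ * (1 - ξ k)) atTop
      (𝓝 (Real.log 2 * 0 + (β + ρ) + κ * 0 * (0 + 0 * 0) - (1 - 0) * κ * (1 - x))) :=
    ((((hlog.inv_tendsto_atTop.const_mul _).add tendsto_const_nhds).add
      ((tendsto_log_div_natCast.const_mul _).mul (hinv.add (hinv.mul hinv)))).sub
      (((tendsto_const_nhds.sub hinv).mul_const _).mul (tendsto_const_nhds.sub hξ)))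
  have h2 := h1.eventually (gt_mem_nhds (show _ < (0 : ℝ) by linarith))
  filter_upwards [h2, hlog.eventually_gt_atTop 0, eventually_ge_atTop 1] with k hk hl hk1
  have hk0 : (0 : ℝ) < k := by exact_mod_cast hk1
  have : chainRate κ k β ρ (ξ k) = (Real.log 2 * (Real.log k)⁻¹ + (β + ρ)
      + κ * (Real.log k / k) * (1 / k + 1 / k * (1 / k)) - (1 - 1 / k) * κ * (1 - ξ k))
      * Real.log k := by
    unfold chainRate
    field_simp
  rw [this]
  exact mul_neg_of_neg_of_pos hk hl

lemma eventually_freshRate_neg {κ β : ℝ} (hκ : β < κ) :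
    ∀ᶠ k : ℕ in atTop, freshRate κ k β < 0 := by
  have hlog := tendsto_log_natCast
  have hinv : Tendsto (fun k : ℕ => 1 / (k : ℝ)) atTop (𝓝 0) := tendsto_one_div_atTop_nhds_zero_nat
  have h1 : Tendsto (fun k : ℕ => β + κ * (Real.log k / k) * (1 / k) - (1 - 1 / k) * κ) atTop
      (𝓝 (β + κ * 0 * 0 - (1 - 0) * κ)) :=
    (tendsto_const_nhds.add ((tendsto_log_div_natCast.const_mul _).mul hinv)).sub
      ((tendsto_const_nhds.sub hinv).mul_const _)
  have h2 := h1.eventually (gt_mem_nhds (show _ < (0 : ℝ) by linarith))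
  filter_upwards [h2, hlog.eventually_gt_atTop 0, eventually_ge_atTop 1] with k hk hl hk1
  have hk0 : (0 : ℝ) < k := by exact_mod_cast hk1
  have : freshRate κ k β = (β + κ * (Real.log k / k) * (1 / k) - (1 - 1 / k) * κ)
      * (Real.log k / k) := by
    unfold freshRate
    field_simp
  rw [this]
  exact mul_neg_of_neg_of_pos hk (by positivity)

/-- Noise of order `1 / k` changes the conditional entropy by at most a small multiple of
`log k / k`. -/
lemma eventually_noise_le {ρ : ℝ} (hρ : 0 < ρ) : ∀ᶠ k : ℕ in atTop,
    -Real.log (1 - ρ / 2 / k) - ρ / 2 / k * Real.log (ρ / 2 / k) ≤ ρ * Real.log k / k := by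
  filter_upwards [tendsto_log_natCast.eventually_ge_atTop (2 - Real.log (ρ / 2)),
    eventually_ge_atTop 1, tendsto_natCast_atTop_atTop.eventually_ge_atTop ρ] with k hk hk1 hkρ
  have hk0 : (0 : ℝ) < k := by exact_mod_cast hk1
  set ε := ρ / 2 / k with hε
  have hε0 : 0 < ε := by positivity
  have hε2 : ε ≤ 1 / 2 := by
    rw [hε, div_le_iff₀ hk0]
    linarith
  have h1 : -Real.log (1 - ε) ≤ 2 * ε := by
    have := Real.one_sub_inv_le_log_of_pos (show 0 < 1 - ε by linarith)
    have h2 : (1 - ε)⁻¹ ≤ 1 + 2 * ε := by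
      rw [inv_le_iff_one_le_mul₀ (by linarith)]
      nlinarith
    linarith
  have h3 : Real.log ε = Real.log (ρ / 2) - Real.log k := by
    rw [hε, Real.log_div (by positivity) hk0.ne']
  have h4 : ρ * Real.log k / k = 2 * ε * Real.log k := by
    rw [hε]
    field_simp
  rw [h3, h4]
  nlinarith

/-! ### Choice of the parameters -/

lemma coViolBound_nonneg {k : ℕ} {z w h : ℝ} (hz : 1 ≤ z) : 0 ≤ coViolBound k z w h := by
  unfold coViolBound
  have : 0 ≤ z := by linarith
  positivity

/-- The bound for chains of words, with the exponential rate made explicit. -/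
lemma chain_bound_le {k n m : ℕ} {κ β ρ ξ : ℝ} (hk : 2 ≤ k) (hξ0 : 0 ≤ ξ)
    (hξ1 : ξ ≤ 1) (hκ : 0 ≤ κ)
    (hm1 : (m : ℝ) ≤ κ * 2 ^ k * Real.log k / k * n)
    (hm2 : κ * 2 ^ k * Real.log k / k * n - 1 ≤ m) {C : ℝ}
    (hC : k * (κ * 2 ^ k * Real.log k / k) + 1 ≤ C) :
    ((k * m + 1) * 2 ^ n) * ((k * m + 1) * ((n + 1 : ℝ) ^ 2 ^ k
          * Real.exp (n * ((β + ρ) * Real.log k / k)))) ^ k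
        * Real.exp (Real.log k * (1 / ((k : ℝ) ^ 2 * 2 ^ k)) * m * (k + 1)
          - (1 - Real.exp (-Real.log k)) * ((1 / 2) ^ k * (1 + k * (1 - ξ))) * m)
      ≤ Real.exp k * (C * n + 1) ^ (k + 1 + 2 ^ k * k) * Real.exp (n * chainRate κ k β ρ ξ) := by
  have hk0 : (0 : ℝ) < k := by positivity
  have hk1 : (2 : ℝ) ≤ k := by exact_mod_cast hk
  have hl : 0 < Real.log k := Real.log_pos (by linarith)
  have hn0 : (0 : ℝ) ≤ n := Nat.cast_nonneg n
  set α := κ * 2 ^ k * Real.log k / k with hα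
  have hα0 : 0 ≤ α := by positivity
  have hkm : (k * m + 1 : ℝ) ≤ C * n + 1 := by nlinarith
  have hn1 : (n + 1 : ℝ) ≤ C * n + 1 := by
    have : 0 ≤ k * α := by positivity
    nlinarith
  have hCn : (0 : ℝ) ≤ C * n + 1 := by linarith
  have e2 : (2 : ℝ) ^ n = Real.exp (n * Real.log 2) := by
    rw [Real.exp_nat_mul, Real.exp_log (by norm_num)]
  have es : Real.exp (-Real.log k) = 1 / k := by
    rw [Real.exp_neg, Real.exp_log hk0, one_div]
  -- the polynomial factors
  have hpoly : ((k * m + 1) * 2 ^ n) * ((k * m + 1) * ((n + 1 : ℝ) ^ 2 ^ k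
          * Real.exp (n * ((β + ρ) * Real.log k / k)))) ^ k
      ≤ (C * n + 1) ^ (k + 1 + 2 ^ k * k)
        * Real.exp (n * Real.log 2 + n * ((β + ρ) * Real.log k)) := by
    have e3 : Real.exp (n * ((β + ρ) * Real.log k / k)) ^ k
        = Real.exp (n * ((β + ρ) * Real.log k)) := by
      rw [← Real.exp_nat_mul]
      congr 1
      field_simp
    rw [mul_pow, mul_pow, e3, ← pow_mul, e2, Real.exp_add, pow_add, pow_add, pow_one]
    calc _ = (((k * m + 1 : ℝ) ^ k * (k * m + 1)) * (n + 1 : ℝ) ^ (2 ^ k * k))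
          * (Real.exp (n * Real.log 2) * Real.exp (n * ((β + ρ) * Real.log k))) := by ring
      _ ≤ _ := by gcongr
  -- the exponent, where `m` is replaced by `α n` up to an error of at most `k`
  have hexp : Real.log k * (1 / ((k : ℝ) ^ 2 * 2 ^ k)) * m * (k + 1)
      - (1 - 1 / k) * ((1 / 2) ^ k * (1 + k * (1 - ξ))) * m
      ≤ k + n * (κ * Real.log k ^ 2 * (k + 1) / (k : ℝ) ^ 3
        - (1 - 1 / k) * κ * (1 - ξ) * Real.log k) := by
    have hk1' : 0 ≤ 1 - 1 / (k : ℝ) := by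
      rw [sub_nonneg, div_le_one hk0]
      linarith
    have hk1'' : 1 - 1 / (k : ℝ) ≤ 1 := by
      have : 0 ≤ 1 / (k : ℝ) := by positivity
      linarith
    have a1 : Real.log k * (1 / ((k : ℝ) ^ 2 * 2 ^ k)) * m * (k + 1)
        ≤ n * (κ * Real.log k ^ 2 * (k + 1) / (k : ℝ) ^ 3) := by
      calc _ ≤ Real.log k * (1 / ((k : ℝ) ^ 2 * 2 ^ k)) * (α * n) * (k + 1) := by gcongr
        _ = _ := by rw [hα]; field_simp
    have hq : 0 ≤ k * (1 - ξ) := mul_nonneg hk0.le (by linarith)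
    have hq1 : k * (1 - ξ) ≤ k := by nlinarith
    have hp0 : (0 : ℝ) ≤ (1 / 2) ^ k := by positivity
    have hp1 : ((1 : ℝ) / 2) ^ k ≤ 1 := pow_le_one₀ (by norm_num) (by norm_num)
    have a2 : (1 - 1 / k) * ((1 / 2) ^ k * (k * (1 - ξ))) * (α * n - 1)
        ≤ (1 - 1 / k) * ((1 / 2) ^ k * (1 + k * (1 - ξ))) * m := by
      calc _ ≤ (1 - 1 / k) * ((1 / 2) ^ k * (k * (1 - ξ))) * (m : ℝ) := by gcongr
        _ ≤ _ := by
          gcongr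
          linarith
    have a3 : (1 - 1 / k) * ((1 / 2) ^ k * (k * (1 - ξ))) ≤ k := by
      calc _ ≤ 1 * (1 * (k : ℝ)) := by gcongr
        _ = k := by ring
    have a4 : (1 - 1 / k) * ((1 / 2) ^ k * (k * (1 - ξ))) * (α * n)
        = n * ((1 - 1 / k) * κ * (1 - ξ) * Real.log k) := by
      rw [hα, div_pow, one_pow]
      field_simp
    linarith
  rw [es]
  refine (mul_le_mul hpoly (Real.exp_le_exp.2 hexp) (Real.exp_pos _).le (by positivity)).trans
    (le_of_eq ?_)
  rw [mul_assoc, ← Real.exp_add, mul_comm (Real.exp (k : ℝ)),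
    mul_assoc ((C * n + 1) ^ (k + 1 + 2 ^ k * k)), ← Real.exp_add]
  congr 2
  unfold chainRate
  ring

/-- The bound for fresh formulas, with the exponential rate made explicit. -/
lemma fresh_bound_le {k n m : ℕ} {κ β : ℝ} (hk : 2 ≤ k) (hκ : 0 ≤ κ)
    (hm1 : (m : ℝ) ≤ κ * 2 ^ k * Real.log k / k * n)
    (hm2 : κ * 2 ^ k * Real.log k / k * n - 1 ≤ m) {C : ℝ}
    (hC : k * (κ * 2 ^ k * Real.log k / k) + 1 ≤ C) :
    k * ((k * m + 1) ^ k * ((k * m + 1) * ((n + 1 : ℝ) ^ 2 ^ k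
          * Real.exp (n * (β * Real.log k / k))
        * Real.exp (Real.log k * (1 / ((k : ℝ) ^ 2 * 2 ^ k)) * m
          - (1 - Real.exp (-Real.log k)) * (1 / 2) ^ k * m))))
      ≤ k * Real.exp 1 * (C * n + 1) ^ (k + 1 + 2 ^ k) * Real.exp (n * freshRate κ k β) := by
  have hk0 : (0 : ℝ) < k := by positivity
  have hk1 : (2 : ℝ) ≤ k := by exact_mod_cast hk
  have hl : 0 < Real.log k := Real.log_pos (by linarith)
  have hn0 : (0 : ℝ) ≤ n := Nat.cast_nonneg n
  set α := κ * 2 ^ k * Real.log k / k with hα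
  have hα0 : 0 ≤ α := by positivity
  have hkm : (k * m + 1 : ℝ) ≤ C * n + 1 := by nlinarith
  have hn1 : (n + 1 : ℝ) ≤ C * n + 1 := by
    have : 0 ≤ k * α := by positivity
    nlinarith
  have hCn : (0 : ℝ) ≤ C * n + 1 := by linarith
  have es : Real.exp (-Real.log k) = 1 / k := by
    rw [Real.exp_neg, Real.exp_log hk0, one_div]
  have hk1' : 0 ≤ 1 - 1 / (k : ℝ) := by
    rw [sub_nonneg, div_le_one hk0]
    linarith
  have hexp : Real.log k * (1 / ((k : ℝ) ^ 2 * 2 ^ k)) * m - (1 - 1 / k) * (1 / 2) ^ k * m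
      ≤ 1 + n * ((κ * Real.log k / (k : ℝ) ^ 2 - (1 - 1 / k) * κ) * (Real.log k / k)) := by
    have a1 : Real.log k * (1 / ((k : ℝ) ^ 2 * 2 ^ k)) * m
        ≤ n * (κ * Real.log k / (k : ℝ) ^ 2 * (Real.log k / k)) := by
      calc _ ≤ Real.log k * (1 / ((k : ℝ) ^ 2 * 2 ^ k)) * (α * n) := by gcongr
        _ = _ := by rw [hα]; field_simp
    have a2 : (1 - 1 / k) * (1 / 2) ^ k * (α * n - 1) ≤ (1 - 1 / k) * (1 / 2) ^ k * (m : ℝ) := by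
      gcongr
    have a3 : (1 - 1 / (k : ℝ)) * (1 / 2) ^ k ≤ 1 := by
      refine mul_le_one₀ ?_ (by positivity) (pow_le_one₀ (by norm_num) (by norm_num))
      have : 0 ≤ 1 / (k : ℝ) := by positivity
      linarith
    have a4 : (1 - 1 / k) * (1 / 2) ^ k * (α * n)
        = n * ((1 - 1 / k) * κ * (Real.log k / k)) := by
      rw [hα, div_pow, one_pow]
      field_simp
    linarith
  rw [es]
  calc _ = k * ((k * m + 1 : ℝ) ^ (k + 1) * (n + 1 : ℝ) ^ 2 ^ k)
        * (Real.exp (n * (β * Real.log k / k)) * Real.exp (Real.log k * (1 / ((k : ℝ) ^ 2 * 2 ^ k)) * m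
          - (1 - 1 / k) * (1 / 2) ^ k * m)) := by ring
    _ ≤ k * ((C * n + 1 : ℝ) ^ (k + 1) * (C * n + 1 : ℝ) ^ 2 ^ k)
        * (Real.exp (n * (β * Real.log k / k)) * Real.exp (1 + n * ((κ * Real.log k / (k : ℝ) ^ 2
          - (1 - 1 / k) * κ) * (Real.log k / k)))) := by gcongr
    _ = _ := by
      rw [← pow_add, ← Real.exp_add, show k * Real.exp 1 * (C * n + 1) ^ (k + 1 + 2 ^ k)
        * Real.exp (n * freshRate κ k β) = k * (C * n + 1) ^ (k + 1 + 2 ^ k)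
        * (Real.exp 1 * Real.exp (n * freshRate κ k β)) by ring, ← Real.exp_add]
      congr 2
      unfold freshRate
      ring

/-- The final comparison, with `X = γ D log n`: the stability probability `exp (-C₃ X)` exceeds the
sum of the probabilities of a failure along the path (at most `S` formulas, each failing with
probability `q`), of the forbidden structure (`t₂`) and of the fresh formulas (`t₃`). -/
lemma no_balance {n C a C₃ X t₂ t₃ q S : ℝ} (hn : 0 < n) (hC : 0 ≤ C)
    (hX1 : Real.log n ≤ X) (hX2 : C₃ * X ≤ a / 2 * n)
    (h8 : 8 * (C * n + 1) ≤ n ^ 2) (h4 : 4 < Real.exp (a / 2 * n))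
    (ht₂ : t₂ ≤ Real.exp (-(a * n))) (ht₃ : t₃ ≤ Real.exp (-(a * n)))
    (hq : q ≤ 2 * Real.exp (-((C₃ + 2) * X))) (hS : S ≤ C * n + 1) (hq0 : 0 ≤ q) :
    S * q + t₂ + t₃ < Real.exp (-(C₃ * X)) := by
  have hE : 0 < Real.exp (-(C₃ * X)) := Real.exp_pos _
  have e1 : Real.exp (-(a * n)) < Real.exp (-(C₃ * X)) / 4 := by
    have h5 : Real.exp (-(a * n)) * Real.exp (a / 2 * n) ≤ Real.exp (-(C₃ * X)) := by
      rw [← Real.exp_add, Real.exp_le_exp]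
      linarith
    have := mul_lt_mul_of_pos_left h4 (Real.exp_pos (-(a * n)))
    linarith
  have e2 : S * q ≤ Real.exp (-(C₃ * X)) / 4 := by
    have h6 : Real.exp (-((C₃ + 2) * X)) = Real.exp (-(C₃ * X)) * Real.exp (-(2 * X)) := by
      rw [← Real.exp_add]
      ring_nf
    have h7 : Real.exp (-(2 * X)) ≤ (n ^ 2)⁻¹ := by
      rw [← Real.exp_log (pow_pos hn 2), ← Real.exp_neg, Real.exp_le_exp, Real.log_pow]
      push_cast
      linarith
    have h9 : 8 * (C * n + 1) * Real.exp (-(2 * X)) ≤ 1 := by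
      refine (mul_le_mul h8 h7 (Real.exp_pos _).le (by positivity)).trans ?_
      rw [mul_inv_cancel₀ (by positivity)]
    calc S * q ≤ (C * n + 1) * (2 * Real.exp (-((C₃ + 2) * X))) :=
          mul_le_mul hS hq hq0 (by positivity)
      _ = (8 * (C * n + 1) * Real.exp (-(2 * X))) * (Real.exp (-(C₃ * X)) / 4) := by
          rw [h6]; ring
      _ ≤ 1 * (Real.exp (-(C₃ * X)) / 4) := mul_le_mul_of_nonneg_right h9 (by positivity)
      _ = _ := one_mul _
  linarith

/-- Hardness for a fixed clause size `k` at which all the asymptotic estimates hold, and a number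
`n` of variables that is large enough for the polynomial factors to be absorbed. -/
theorem not_solves_of_rates {κ β ρ a C₃ C : ℝ} {k n m : ℕ} (hk : 2 ≤ k) (hκ : 0 < κ) (hβ : 1 < β)
    (hρ : 0 < ρ) (hlog : 1 < Real.log k) (hρk : ρ < k)
    (hξ : coViolBound k β (truncLevel k) (β * Real.log k / k) ≤ 1)
    (hchain : chainRate κ k β ρ (coViolBound k β (truncLevel k) (β * Real.log k / k)) ≤ -(2 * a))
    (hfresh : freshRate κ k β ≤ -(2 * a)) (ha : 0 < a)
    (hnoise : -Real.log (1 - ρ / 2 / k) - ρ / 2 / k * Real.log (ρ / 2 / k)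
      ≤ ρ * Real.log k / k)
    (hC₃ : C₃ = 16 * (k : ℝ) ^ 2 / (4 * (ρ / 6 / k)))
    (hC : C = k * (κ * 2 ^ k * Real.log k / k) + 1)
    (hn2 : (2 : ℝ) ≤ n) (hn8 : 8 * C + 8 ≤ n) (hexp4 : 4 < Real.exp (a / 2 * n))
    (hp1 : Real.exp k * (C * n + 1) ^ (k + 1 + 2 ^ k * k) ≤ Real.exp (a * n))
    (hp2 : k * Real.exp 1 * (C * n + 1) ^ (k + 1 + 2 ^ k) ≤ Real.exp (a * n))
    (hm0 : m ≠ 0) (hm1 : (m : ℝ) ≤ κ * 2 ^ k * Real.log k / k * n)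
    (hm2 : κ * 2 ^ k * Real.log k / k * n - 1 ≤ m)
    {γ : ℝ} (hγ : 1 ≤ γ) {D : ℕ} (hD : 1 ≤ D) (hDn : (D : ℝ) ≤ a / 2 / C₃ * n / (γ * Real.log n))
    {δ : ℝ} (hδ : δ ≤ Real.exp (-((C₃ + 2) * γ * D * Real.log n))) {Ω : Type*} [MeasurableSpace Ω]
    {P : Measure Ω} [IsProbabilityMeasure P]
    {f : (InputIndex k n m → ℝ) → Ω → EuclideanSpace ℝ (Fin n)} (hf : IsRandomDegreePoly D f) :
    ¬ Solves P f δ γ (ρ / 6 / k) (1 / ((k : ℝ) ^ 2 * 2 ^ k)) := by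
  intro hsol
  have hk0 : (0 : ℝ) < k := by positivity
  have hα0 : 0 < κ * 2 ^ k * Real.log k / k := by positivity
  have hC0 : 0 ≤ C := by rw [hC]; positivity
  have hr0 : 0 < 4 * (ρ / 6 / k) := by positivity
  have hC₃0 : 0 < C₃ := by rw [hC₃]; positivity
  have hn0 : (0 : ℝ) < n := by linarith
  have hγ0 : 0 < γ := by linarith
  have hlogn : 0 < Real.log n := Real.log_pos (by linarith)
  have hD1 : (1 : ℝ) ≤ D := by exact_mod_cast hD
  have : NeZero n := ⟨by rintro rfl; simp at hn0⟩
  have : NeZero m := ⟨hm0⟩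
  obtain ⟨X, hX⟩ : ∃ X, X = γ * D * Real.log n := ⟨_, rfl⟩
  have hX1 : Real.log n ≤ X := by
    rw [hX]
    exact le_mul_of_one_le_left hlogn.le (one_le_mul_of_one_le_of_one_le hγ hD1)
  have hX2 : C₃ * X ≤ a / 2 * n := by
    rw [le_div_iff₀ (by positivity)] at hDn
    calc C₃ * X = C₃ * (D * (γ * Real.log n)) := by rw [hX]; ring
      _ ≤ C₃ * (a / 2 / C₃ * n) := mul_le_mul_of_nonneg_left hDn hC₃0.le
      _ = a / 2 * n := by field_simp
  obtain ⟨g, hg, hfail, hnorm⟩ := exists_deterministic hf hsol hδ (Real.exp_pos _) hγ0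
  have hmain := exp_neg_stability_le hg (η := ρ / 6 / k) (ν := 1 / ((k : ℝ) ^ 2 * 2 ^ k))
    (r := 4 * (ρ / 6 / k))
    (ε := ρ / 2 / k) (h₀ := β * Real.log k / k) (h₁ := (β + ρ) * Real.log k / k)
    (w := truncLevel k) (z := β) (s := Real.log k) hr0 (by positivity)
    (by rw [div_div, div_lt_one (by positivity)]; linarith)
    (le_of_eq (by ring))
    (by positivity) (hnoise.trans (le_of_eq (by ring)))
    (add_pos (by linarith) (Real.log_pos hlog)) hβ.le (by linarith)
  have t2 := (chain_bound_le (β := β) (ρ := ρ) hk (coViolBound_nonneg hβ.le) hξ hκ.le hm1 hm2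
    hC.ge).trans (mul_le_mul_of_nonneg_right hp1 (Real.exp_pos _).le)
  have t3 := (fresh_bound_le (β := β) hk hκ.le hm1 hm2 hC.ge).trans
    (mul_le_mul_of_nonneg_right hp2 (Real.exp_pos _).le)
  rw [← Real.exp_add] at t2 t3
  have hS : (k * m + 1 : ℝ) ≤ C * n + 1 := by
    have := mul_le_mul_of_nonneg_left hm1 hk0.le
    rw [hC]
    linarith
  have hq : prob (fun Φ : Formula k n m => ¬ EtaNuSatisfies (ρ / 6 / k) (1 / ((k : ℝ) ^ 2 * 2 ^ k))
      (fun i => roundOutput (g (encode Φ) i)) Φ) ≤ 2 * Real.exp (-((C₃ + 2) * X)) := by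
    refine hfail.trans (le_of_eq ?_)
    rw [hX, mul_assoc, mul_assoc, ← mul_assoc γ]
  have r2 := mul_le_mul_of_nonneg_left hchain hn0.le
  have r3 := mul_le_mul_of_nonneg_left hfresh hn0.le
  have hbal := no_balance hn0 hC0 hX1 hX2
    (by linarith [mul_le_mul_of_nonneg_right hn8 hn0.le, sq (n : ℝ)]) hexp4
    (t2.trans (Real.exp_le_exp.2 (by linarith))) (t3.trans (Real.exp_le_exp.2 (by linarith)))
    hq hS (prob_nonneg _)
  refine absurd (hmain.trans_lt hbal) (not_lt.2 (Real.exp_le_exp.2 (neg_le_neg ?_)))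
  -- the total change of `g` along the path, in units of the admissible change per step
  have hlog2n : Real.log (2 * n) ≤ 2 * Real.log n := by
    rw [Real.log_mul (by norm_num) hn0.ne']
    linarith [Real.log_le_log (by norm_num) hn2]
  have hnorm' : 𝔼 Φ : Formula k n m, ‖g (encode Φ)‖ ^ 2 / (4 * (ρ / 6 / k) * n)
      ≤ 2 * γ / (4 * (ρ / 6 / k)) := by
    rw [← expect_div, div_le_div_iff₀ (by positivity) hr0]
    exact (mul_le_mul_of_nonneg_right hnorm hr0.le).trans (le_of_eq (by ring))
  have hnorm0 : 0 ≤ 𝔼 Φ : Formula k n m, ‖g (encode Φ)‖ ^ 2 / (4 * (ρ / 6 / k) * n) :=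
    expect_nonneg fun _ _ => by positivity
  calc 2 * (k * Real.log (2 * n)) * (k * (2 * D * 𝔼 Φ : Formula k n m,
        ‖g (encode Φ)‖ ^ 2 / (4 * (ρ / 6 / k) * n)))
      ≤ 2 * (k * (2 * Real.log n)) * (k * (2 * D * (2 * γ / (4 * (ρ / 6 / k))))) := by gcongr
    _ = C₃ * X := by
      rw [hC₃, hX]
      ring

/-- Hardness for a fixed clause size `k` at which all the asymptotic estimates hold. -/
theorem hardness_of_rates {κ β ρ : ℝ} {k : ℕ} (hk : 2 ≤ k) (hκ : 0 < κ) (hβ : 1 < β) (hρ : 0 < ρ)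
    (hlog : 1 < Real.log k) (hρk : ρ < k)
    (hξ : coViolBound k β (truncLevel k) (β * Real.log k / k) ≤ 1)
    (hchain : chainRate κ k β ρ (coViolBound k β (truncLevel k) (β * Real.log k / k)) < 0)
    (hfresh : freshRate κ k β < 0)
    (hnoise : -Real.log (1 - ρ / 2 / k) - ρ / 2 / k * Real.log (ρ / 2 / k)
      ≤ ρ * Real.log k / k) :
    ∃ (nStar : ℕ) (C₁ C₂ : ℝ), 0 < nStar ∧ 0 < C₁ ∧ 0 < C₂ ∧
      ∀ n : ℕ, nStar ≤ n → ∀ γ : ℝ, 1 ≤ γ →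
        ∀ D : ℕ, 1 ≤ D → (D : ℝ) ≤ C₁ * n / (γ * Real.log n) →
          ∀ δ : ℝ, δ ≤ Real.exp (-(C₂ * γ * D * Real.log n)) →
            ∀ (Ω : Type*) [MeasurableSpace Ω] (P : Measure Ω) [IsProbabilityMeasure P]
              (f : (InputIndex k n (numClauses κ k n) → ℝ) → Ω → EuclideanSpace ℝ (Fin n)),
              IsRandomDegreePoly D f →
                ¬ Solves P f δ γ (ρ / 6 / k) (1 / ((k : ℝ) ^ 2 * 2 ^ k)) := by
  have hk0 : (0 : ℝ) < k := by positivity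
  have hα0 : 0 < κ * 2 ^ k * Real.log k / k := by positivity
  obtain ⟨C, hC⟩ : ∃ C, C = k * (κ * 2 ^ k * Real.log k / k) + 1 := ⟨_, rfl⟩
  have hC0 : 0 ≤ C := by rw [hC]; positivity
  -- half the smaller of the two exponential rates
  obtain ⟨a, ha, ha1, ha2⟩ : ∃ a : ℝ, 0 < a ∧
      chainRate κ k β ρ (coViolBound k β (truncLevel k) (β * Real.log k / k)) ≤ -(2 * a) ∧
      freshRate κ k β ≤ -(2 * a) := by
    generalize chainRate κ k β ρ (coViolBound k β (truncLevel k) (β * Real.log k / k)) = A at *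
    refine ⟨min (-A) (-freshRate κ k β) / 2, ?_, ?_, ?_⟩
    · exact half_pos (lt_min (by linarith) (by linarith))
    · linarith [min_le_left (-A) (-freshRate κ k β)]
    · linarith [min_le_right (-A) (-freshRate κ k β)]
  obtain ⟨C₃, hC₃⟩ : ∃ C₃, C₃ = 16 * (k : ℝ) ^ 2 / (4 * (ρ / 6 / k)) := ⟨_, rfl⟩
  have hC₃0 : 0 < C₃ := by rw [hC₃]; positivity
  obtain ⟨N, hN⟩ := eventually_atTop.1
    ((tendsto_natCast_atTop_atTop.eventually_ge_atTop (2 : ℝ)).and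
      (((tendsto_natCast_atTop_atTop.const_mul_atTop hα0).eventually_ge_atTop (1 : ℝ)).and
      ((tendsto_natCast_atTop_atTop.eventually_ge_atTop (8 * C + 8)).and
      ((eventually_pow_le_exp (M := 5) hC0 (half_pos ha) 0).and
      ((eventually_pow_le_exp hC0 ha (k + 1 + 2 ^ k * k)).and
      (eventually_pow_le_exp hC0 ha (k + 1 + 2 ^ k)))))))
  refine ⟨max N 1, a / 2 / C₃, C₃ + 2, by positivity, by positivity, by positivity, ?_⟩
  intro n hn γ hγ D hD hDn δ hδ Ω _ P _ f hf
  obtain ⟨hn2, hαn, hn8, hexp4, hp1, hp2⟩ := hN n (le_of_max_le_left hn)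
  exact not_solves_of_rates hk hκ hβ hρ hlog hρk hξ ha1 ha2 ha hnoise hC₃ hC hn2 hn8
    (by rw [pow_zero] at hexp4; linarith) hp1 hp2 (Nat.floor_pos.2 hαn).ne'
    (Nat.floor_le (by positivity)) (Nat.sub_one_lt_floor _).le hγ hD hDn hδ hf

end

end RandomKSAT

theorem theorem2p1 (κ : ℝ) (hκ : RandomKSAT.kappaStar < κ) :
    ∃ c : ℝ, 0 < c ∧ ∃ kStar : ℕ, 0 < kStar ∧ ∀ k : ℕ, kStar ≤ k →
      ∃ (nStar : ℕ) (η C₁ C₂ : ℝ), 0 < nStar ∧ c / k ≤ η ∧ η ≤ 1 ∧ 0 < C₁ ∧ 0 < C₂ ∧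
        ∀ n : ℕ, nStar ≤ n → ∀ γ : ℝ, 1 ≤ γ →
          ∀ D : ℕ, 1 ≤ D → (D : ℝ) ≤ C₁ * n / (γ * Real.log n) →
            ∀ δ : ℝ, 0 ≤ δ → δ ≤ Real.exp (-(C₂ * γ * D * Real.log n)) →
              ∀ (Ω : Type*) [MeasurableSpace Ω] (P : MeasureTheory.Measure Ω)
                [MeasureTheory.IsProbabilityMeasure P],
                ¬ ∃ f : (RandomKSAT.InputIndex k n (RandomKSAT.numClauses κ k n) → ℝ) → Ω →
                    EuclideanSpace ℝ (Fin n),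
                  RandomKSAT.IsRandomDegreePoly D f ∧
                    RandomKSAT.Solves P f δ γ η (1 / ((k : ℝ) ^ 2 * 2 ^ k)) := by
  obtain ⟨⟨β, hβ, hι⟩, -⟩ := RandomKSAT.kappaStar_isLeast
  replace hβ : 1 < β := hβ
  have hden := RandomKSAT.iota_denom_pos hβ
  set x := β * Real.exp (-(β - 1)) with hx
  have hx0 : 0 < x := mul_pos (by linarith) (Real.exp_pos _)
  have hβκ : β < κ * (1 - x) := by
    rw [← hι, RandomKSAT.iota, div_lt_iff₀ hden] at hκ
    exact hκ
  have hκ0 : 0 < κ := pos_of_mul_pos_left (by linarith) hden.le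
  set ρ := (κ * (1 - x) - β) / 2 with hρ
  have hρ0 : 0 < ρ := by linarith
  have hlim := RandomKSAT.tendsto_coViolBound hβ
  have hev : ∀ᶠ k : ℕ in Filter.atTop, _ :=
    ((Filter.eventually_ge_atTop 2).and
      ((RandomKSAT.tendsto_log_natCast.eventually_gt_atTop 1).and
      ((tendsto_natCast_atTop_atTop.eventually_gt_atTop ρ).and
      ((hlim.eventually (ge_mem_nhds (show x < 1 by linarith))).and
      ((RandomKSAT.eventually_chainRate_neg hlim (show β + ρ < κ * (1 - x) by linarith)).and
      ((RandomKSAT.eventually_freshRate_neg (show β < κ by nlinarith)).and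
      (RandomKSAT.eventually_noise_le hρ0)))))))
  obtain ⟨N, hN⟩ := Filter.eventually_atTop.1 hev
  refine ⟨ρ / 6, by positivity, max N 1, by positivity, fun k hk => ?_⟩
  obtain ⟨h2, hlog, hρk, hξ, hchain, hfresh, hnoise⟩ := hN k (le_of_max_le_left hk)
  obtain ⟨nStar, C₁, C₂, hn, hC₁, hC₂, hmain⟩ :=
    RandomKSAT.hardness_of_rates h2 hκ0 hβ hρ0 hlog hρk hξ hchain hfresh hnoise
  refine ⟨nStar, ρ / 6 / k, C₁, C₂, hn, le_rfl, ?_, hC₁, hC₂, ?_⟩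
  · rw [div_div]
    exact div_le_one_of_le₀ (by linarith) (by positivity)
  · intro n hn γ hγ D hD hDn δ _ hδ Ω _ P _ ⟨f, hf, hs⟩
    exact hmain n hn γ hγ D hD hDn δ hδ Ω P f hf hs
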